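/- Let $\mathcal{A}$ be a von Neumann algebra acting on a Hilbert space $\mathcal{H}$, with a faithful normal trace state $\tau$, and let $A, X_1, X_2$ be random variables, that is, (possibly unbounded) selfadjoint operators on $\mathcal{H}$ whose resolvents $(i1_{\mathcal{A}}-A)^{-1}$, $(i1_{\mathcal{A}}-X_j)^{-1}$ belong to $\mathcal{A}$. Sums, products and matrices of operators affiliated with $\mathcal{A}$ are understood, as usual, as the closures of the corresponding operators on their natural domains, and $\ker(T)$ denotes the orthogonal projection onto the null space of $T$ (the greatest projection $p$ with $Tp=0$). Let $P(Z_1,Z_2)$ be a complex polynomial in two noncommuting indeterminates, let $m\in\mathbb{N}$, $n=1+m$, and let $B, C, D, D'$ be matrices of complex polynomials in $Z_1,Z_2$ of sizes $1\times m$, $m\times 1$, $m\times m$, $m\times m$, respectively, such that * the entries of $B$, $C$ and $D$ are linear, i.e. of the form $c_0+c_1Z_1+c_2Z_2$ with $c_0,c_1,c_2\in\mathbb{C}$; * $DD'=D'D=1_m$; * $BD'C=P$. Let $$L(Z_1,Z_2)=\begin{bmatrix}0 & B(Z_1,Z_2)\\ C(Z_1,Z_2) & D(Z_1,Z_2)\end{bmatrix}$$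 be the corresponding linearization of $P$, and let $e_{1,1}\in M_n(\mathbb{C})$ be the matrix unit whose only nonzero entry is in the first row and first column. Then the projections $\ker(A\otimes e_{1,1}+L(X_1,X_2))$ and $\ker(A-P(X_1,X_2))\oplus(0_{n-1}\otimes 1_{\mathcal{A}})$ belong to $M_n(\mathcal{A})$ and are Murray–von Neumann equivalent in $M_n(\mathcal{A})$. In particular, with $\tau_n={\rm tr}_n\otimes\tau$ the normalized trace on $M_n(\mathcal{A})$, $$n\,\tau_n\bigl(\ker(A\otimes e_{1,1}+L(X_1,X_2))\bigr)=\tau\bigl(\ker(A-P(X_1,X_2))\bigr).$$ -/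

import Mathlib

open scoped ComplexOrder

noncomputable section

/-! ### Tracial von Neumann algebras and their random variables -/

section Tracial

variable {H : Type*} [NormedAddCommGroup H] [InnerProductSpace ℂ H] [CompleteSpace H]

/-- `τ` is a faithful normal trace state on the von Neumann algebra `𝒜`.  Normality is expressed
by preservation of suprema of upwards directed sets of positive elements (the order on `𝒜` is the
usual order between operators). -/
structure IsFaithfulNormalTraceState (𝒜 : VonNeumannAlgebra H)
    (τ : 𝒜.toStarSubalgebra →ₗ[ℂ] ℂ) : Prop where
  map_one : τ 1 = 1
  nonneg : ∀ a, 0 ≤ τ (star a * a)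
  tracial : ∀ a b, τ (a * b) = τ (b * a)
  faithful : ∀ a, τ (star a * a) = 0 → a = 0
  normal : ∀ (S : Set 𝒜.toStarSubalgebra) (s : 𝒜.toStarSubalgebra),
    S.Nonempty → DirectedOn (· ≤ ·) S → (∀ a ∈ S, 0 ≤ a) → IsLUB S s →
      IsLUB ((fun a => (τ a).re) '' S) (τ s).re

/-- A random variable: a (possibly unbounded) selfadjoint operator `X` on `H` such that
`(i - X)⁻¹` exists as an everywhere defined operator and belongs to `𝒜`. -/
structure IsRandomVariable (𝒜 : VonNeumannAlgebra H) (X : H →ₗ.[ℂ] H) : Prop where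
  selfAdjoint : IsSelfAdjoint X
  resolvent_mem : ∃ R ∈ 𝒜,
    (∀ ξ : X.domain, R (Complex.I • (ξ : H) - X ξ) = ξ) ∧
    (∀ η : H, ∃ h : R η ∈ X.domain, Complex.I • R η - X ⟨R η, h⟩ = η)

end Tracial

/-! ### Unbounded operators -/

section Unbounded

variable {E : Type*} [NormedAddCommGroup E] [InnerProductSpace ℂ E]

/-- The composition `S ∘ T` of unbounded operators on its natural domain
`{ξ ∈ dom T | T ξ ∈ dom S}`. -/
def naturalComp (S T : E →ₗ.[ℂ] E) : E →ₗ.[ℂ] E where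
  domain := (S.domain.comap T.toFun).map T.domain.subtype
  toFun :=
    { toFun := fun ξ => S ⟨T ⟨ξ, by
          obtain ⟨_, ⟨y, _, rfl⟩⟩ := ξ; exact y.2⟩, by
          obtain ⟨_, ⟨y, hy, rfl⟩⟩ := ξ; exact hy⟩
      map_add' := fun ξ η => by
        rw [← LinearPMap.map_add]; congr 1; ext; exact T.map_add ⟨ξ, _⟩ ⟨η, _⟩
      map_smul' := fun c ξ => by
        rw [RingHom.id_apply, ← LinearPMap.map_smul]; congr 1; ext
        exact T.map_smul c ⟨ξ, _⟩ }

/-- The identity operator, with domain `E`. -/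
def idPMap : E →ₗ.[ℂ] E := LinearMap.id.toPMap ⊤

/-- The monomial `X_{i₁} X_{i₂} ⋯ X_{iₖ}` on its natural domain. -/
def wordPMap {ι : Type*} (X : ι → E →ₗ.[ℂ] E) : List ι → E →ₗ.[ℂ] E
  | [] => idPMap
  | i :: w => naturalComp (X i) (wordPMap X w)

/-- The noncommutative polynomial `p = ∑ c_w w` evaluated at `X` on its natural domain, which is
the intersection of the natural domains of the monomials that occur in `p`. -/
def naturalEval {ι : Type*} (X : ι → E →ₗ.[ℂ] E) (p : FreeAlgebra ℂ ι) : E →ₗ.[ℂ] E :=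
  ∑ w ∈ (FreeAlgebra.equivMonoidAlgebraFreeMonoid p).coeff.support,
    (FreeAlgebra.equivMonoidAlgebraFreeMonoid p).coeff w • wordPMap X (FreeMonoid.toList w)

/-- The operator `p(X)`, as an element of the algebra of operators affiliated with a finite von
Neumann algebra: sums and products of affiliated operators are the closures of the sums and
products formed on natural domains. -/
def polyEval {ι : Type*} (X : ι → E →ₗ.[ℂ] E) (p : FreeAlgebra ℂ ι) : E →ₗ.[ℂ] E :=
  (naturalEval X p).closure

/-- The difference of two affiliated operators: the closure of the difference formed on the
intersection of the domains. -/
def closedSub (S T : E →ₗ.[ℂ] E) : E →ₗ.[ℂ] E := (S - T).closure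

/-- A square matrix of unbounded operators on `E`, acting on the Hilbert space `Eⁿ` by
`(M ξ)ᵢ = ∑ⱼ Mᵢⱼ ξⱼ` on its natural domain. -/
def naturalMatrixPMap {n : Type*} [Fintype n] (M : Matrix n n (E →ₗ.[ℂ] E)) :
    PiLp 2 (fun _ : n => E) →ₗ.[ℂ] PiLp 2 (fun _ : n => E) where
  domain :=
    { carrier := {ξ | ∀ i j, ξ j ∈ (M i j).domain}
      add_mem' := fun hξ hη i j => (M i j).domain.add_mem (hξ i j) (hη i j)
      zero_mem' := fun i j => (M i j).domain.zero_mem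
      smul_mem' := fun c _ hξ i j => (M i j).domain.smul_mem c (hξ i j) }
  toFun :=
    { toFun := fun ξ => WithLp.toLp 2 fun i => ∑ j, M i j ⟨ξ.1 j, ξ.2 i j⟩
      map_add' := fun ξ η => by
        ext i
        simp only [PiLp.add_apply, ← Finset.sum_add_distrib]
        exact Finset.sum_congr rfl fun j _ => (M i j).map_add ⟨ξ.1 j, ξ.2 i j⟩ ⟨η.1 j, η.2 i j⟩
      map_smul' := fun c ξ => by
        ext i
        simp only [PiLp.smul_apply, Finset.smul_sum, RingHom.id_apply]
        exact Finset.sum_congr rfl fun j _ => (M i j).map_smul c ⟨ξ.1 j, ξ.2 i j⟩ }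

/-- A square matrix of affiliated operators, as an operator on `Eⁿ` affiliated with the matrix
algebra: the closure of the operator on the natural domain. -/
def matrixPMap {n : Type*} [Fintype n] (M : Matrix n n (E →ₗ.[ℂ] E)) :
    PiLp 2 (fun _ : n => E) →ₗ.[ℂ] PiLp 2 (fun _ : n => E) :=
  (naturalMatrixPMap M).closure

/-- The null space `{ξ ∈ dom T | T ξ = 0}`. -/
def nullSpace (T : E →ₗ.[ℂ] E) : Submodule ℂ E :=
  (LinearMap.ker T.toFun).map T.domain.subtype

/-- `p = ker T`: the bounded operator `p` is the orthogonal projection onto the null space of `T`.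
It is then the greatest projection `p` with `T p = 0`. -/
structure IsKernelProjection [CompleteSpace E] (T : E →ₗ.[ℂ] E) (p : E →L[ℂ] E) : Prop where
  isStarProjection : IsStarProjection p
  range_eq : LinearMap.range (p : E →ₗ[ℂ] E) = nullSpace T

end Unbounded

/-! ### Matrices over a von Neumann algebra -/

section Matrices

variable {H : Type*} [NormedAddCommGroup H] [InnerProductSpace ℂ H] [CompleteSpace H]

/-- A matrix over `𝒜` as a bounded operator on the Hilbert space `Hⁿ`. -/
def matrixToCLM {𝒜 : VonNeumannAlgebra H} {n : Type*} [Fintype n]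
    (M : Matrix n n 𝒜.toStarSubalgebra) :
    PiLp 2 (fun _ : n => H) →L[ℂ] PiLp 2 (fun _ : n => H) :=
  (PiLp.continuousLinearEquiv 2 ℂ (fun _ : n => H)).symm.toContinuousLinearMap ∘L
    ContinuousLinearMap.pi fun i => ∑ j, (M i j : H →L[ℂ] H) ∘L PiLp.proj 2 (fun _ : n => H) j

/-- The normalized trace `τₙ = trₙ ⊗ τ` on the `n × n` matrices over `𝒜`. -/
def matrixTrace {𝒜 : VonNeumannAlgebra H} (τ : 𝒜.toStarSubalgebra →ₗ[ℂ] ℂ)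
    {n : Type*} [Fintype n] (M : Matrix n n 𝒜.toStarSubalgebra) : ℂ :=
  (Fintype.card n : ℂ)⁻¹ * ∑ i, τ (M i i)

/-- Murray–von Neumann equivalence of projections in a `*`-algebra. -/
def MurrayVonNeumannEquiv {R : Type*} [Mul R] [Star R] (p q : R) : Prop :=
  ∃ v : R, star v * v = p ∧ v * star v = q

/-- A noncommutative polynomial of the form `c₀ + ∑ᵢ cᵢ Zᵢ`. -/
def IsLinearPolynomial {ι : Type*} [Fintype ι] (p : FreeAlgebra ℂ ι) : Prop :=
  ∃ (c₀ : ℂ) (c : ι → ℂ), p = algebraMap ℂ _ c₀ + ∑ i, c i • FreeAlgebra.ι ℂ i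

/-- The block matrix `L = [0 B; C D]` of polynomials. -/
def linearizationMatrix {ι : Type*} {m : ℕ} (B : Matrix (Fin 1) (Fin m) (FreeAlgebra ℂ ι))
    (C : Matrix (Fin m) (Fin 1) (FreeAlgebra ℂ ι)) (D : Matrix (Fin m) (Fin m) (FreeAlgebra ℂ ι)) :
    Matrix (Fin 1 ⊕ Fin m) (Fin 1 ⊕ Fin m) (FreeAlgebra ℂ ι) :=
  Matrix.fromBlocks 0 B C D

/-- The operator `A ⊗ e₁₁ + L(X)`. -/
def shiftedLinearization {ι : Type*} {m : ℕ} (A : H →ₗ.[ℂ] H) (X : ι → H →ₗ.[ℂ] H)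
    (L : Matrix (Fin 1 ⊕ Fin m) (Fin 1 ⊕ Fin m) (FreeAlgebra ℂ ι)) :
    PiLp 2 (fun _ : Fin 1 ⊕ Fin m => H) →ₗ.[ℂ] PiLp 2 (fun _ : Fin 1 ⊕ Fin m => H) :=
  matrixPMap (Matrix.single (Sum.inl 0) (Sum.inl 0) A + L.map (polyEval X))

end Matrices

end

noncomputable section

/-! ### Polar decomposition of a bounded operator -/

section Polar

variable {K : Type*} [NormedAddCommGroup K] [InnerProductSpace ℂ K] [CompleteSpace K]

/-! Over a ring the statement is a Schur complement: since `D` has inverse `D'`, the system `a u + B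
v = 0`, `C u + D v = 0` says the same as `(a - B D' C) u = 0` and `v = -D' C u`. Hence the first
coordinate maps the kernel of `A ⊗ e₁₁ + L` injectively into that of `A - P`. It need not be onto,
because `D' C u` may fail to be a vector of `H`, but its range is dense there. The polar
decomposition of this coordinate map on the kernel is the required partial isometry; it lies in the
matrix algebra over `𝒜`, and traciality gives the formula for the traces.

The work is to justify such algebra for unbounded operators. The trace makes `𝒜` finite, so the
adjoint of an injective element is injective and the injective elements satisfy both Ore conditions
(`exists_right_ore`, `exists_left_ore`). Thus `𝒜` has a ring of fractions `Q`, and localizing `H` as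
well gives a `Q`-module `E` containing `H`, in which `q • ξ` makes sense for every `ξ`
(`exists_fractionModel`). A random variable becomes an element `q`, its graph being `{(ξ, η) | q • ξ
= η}`.

The key analytic fact is `mem_graph_closure`: an operator that acts through a matrix over `Q`, on a
domain containing the range of an injective element, has the full graph of that matrix as closure.
So closures of natural sums and products compute the operations of `Q`, evaluation at `X` is a ring
homomorphism (`hasGraph_polyEval`), the identity `D D' = 1` survives evaluation, and
`schur_system_iff` applies in `E`. -/

theorem norm_cfcAbs_apply (x : K →L[ℂ] K) (ξ : K) : ‖CFC.abs x ξ‖ = ‖x ξ‖ := by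
  have hs : star (CFC.abs x) = CFC.abs x := (CFC.abs_nonneg x).isSelfAdjoint
  have h : ∀ y : K →L[ℂ] K, (inner ℂ (y ξ) (y ξ)) = inner ℂ ((star y * y) ξ) ξ := fun y => by
    rw [mul_apply_eq_comp, ContinuousLinearMap.star_eq_adjoint,
      ContinuousLinearMap.adjoint_inner_left]
  have h2 : inner ℂ (CFC.abs x ξ) (CFC.abs x ξ) = inner ℂ (x ξ) (x ξ) := by
    rw [h, h, hs, CFC.abs_mul_abs]
  rw [inner_self_eq_norm_sq_to_K, inner_self_eq_norm_sq_to_K] at h2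
  have h3 : ‖CFC.abs x ξ‖ ^ 2 = ‖x ξ‖ ^ 2 := by exact_mod_cast h2
  exact (sq_eq_sq₀ (norm_nonneg _) (norm_nonneg _)).1 h3

/-- The polar decomposition: `v` is a partial isometry from `(ker x)ᗮ` onto `(ker x*)ᗮ`, and it
commutes with all operators that commute with `x` and `x*`. -/
theorem exists_polar_partialIsometry (x : K →L[ℂ] K) :
    ∃ v : K →L[ℂ] K, star v * v = 1 - (LinearMap.ker (x : K →ₗ[ℂ] K)).starProjection ∧
      v * star v = 1 - (LinearMap.ker ((star x : K →L[ℂ] K) : K →ₗ[ℂ] K)).starProjection ∧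
      ∀ c, Commute c x → Commute (star c) x → Commute c v := by
  set A : K →L[ℂ] K := CFC.abs x with hA
  have hAs : star A = A := (CFC.abs_nonneg x).isSelfAdjoint
  have hAadj : ∀ ξ η, inner ℂ (A ξ) η = inner ℂ ξ (A η) := fun ξ η => by
    rw [← ContinuousLinearMap.adjoint_inner_right, ← ContinuousLinearMap.star_eq_adjoint, hAs]
  have hAA : A * A = star x * x := CFC.abs_mul_abs x
  have hAker : ∀ ξ, x ξ = 0 → A ξ = 0 := fun ξ h => by
    rw [← norm_eq_zero, norm_cfcAbs_apply, h, norm_zero]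
  set N := LinearMap.ker (x : K →ₗ[ℂ] K)
  have memN : ∀ ξ, ξ ∈ N ↔ x ξ = 0 := fun ξ => LinearMap.mem_ker
  -- The partial isometry is the extension of `|x| ξ + ν ↦ x ξ` for `ν ∈ ker x`. It is contractive
  -- because `|x| ξ` is orthogonal to `ker x` and has the norm of `x ξ`.
  let e : K × N →ₗ[ℂ] K := (A : K →ₗ[ℂ] K).coprod N.subtype
  let f : K × N →ₗ[ℂ] K := (x : K →ₗ[ℂ] K) ∘ₗ LinearMap.fst ℂ K N
  have he : ∀ z, e z = A z.1 + z.2 := fun z => by simp [e]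
  have hf : ∀ z, f z = x z.1 := fun z => rfl
  have horth : ∀ z : K × N, inner ℂ (A z.1) (z.2 : K) = 0 := fun z => by
    rw [hAadj, hAker _ ((memN _).1 z.2.2), inner_zero_right]
  have hdense : DenseRange e := by
    rw [DenseRange, ← LinearMap.coe_range, Submodule.dense_iff_topologicalClosure_eq_top,
      Submodule.topologicalClosure_eq_top_iff, Submodule.eq_bot_iff]
    intro u hu
    rw [Submodule.mem_orthogonal] at hu
    have h1 : A u = 0 := by
      have := hu (e (A u, 0)) ⟨_, rfl⟩
      rw [he] at this
      simp only [ZeroMemClass.coe_zero, add_zero] at this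
      rw [hAadj] at this
      exact inner_self_eq_zero.1 this
    have h2 : u ∈ N := by
      rw [memN, ← norm_eq_zero, ← norm_cfcAbs_apply, ← hA, h1, norm_zero]
    have := hu (e (0, ⟨u, h2⟩)) ⟨_, rfl⟩
    rw [he] at this
    simpa using this
  have hnorm : ∃ C : ℝ, ∀ z, ‖f z‖ ≤ C * ‖e z‖ := by
    refine ⟨1, fun z => ?_⟩
    rw [one_mul, hf, he, ← norm_cfcAbs_apply]
    have := norm_add_sq_eq_norm_sq_add_norm_sq_of_inner_eq_zero _ _ (horth z)
    nlinarith [norm_nonneg (A z.1), norm_nonneg (A z.1 + z.2), norm_nonneg (z.2 : K)]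
  let v : K →L[ℂ] K := f.extendOfNorm e
  have hv : ∀ z : K × N, v (A z.1 + z.2) = x z.1 := fun z => by
    rw [← he, ← hf]; exact LinearMap.extendOfNorm_eq hdense hnorm z
  have ext_e : ∀ S T : K →L[ℂ] K, (∀ z : K × N, S (A z.1 + z.2) = T (A z.1 + z.2)) → S = T := by
    intro S T h
    ext u
    refine congrFun (hdense.equalizer S.continuous T.continuous (funext fun z => ?_)) u
    simpa only [Function.comp, he] using h z
  have hvA : ∀ ξ, v (A ξ) = x ξ := fun ξ => by simpa using hv (ξ, 0)
  have ext_inner : ∀ a b : K, (∀ z : K × N, inner ℂ a (A z.1 + z.2) = inner ℂ b (A z.1 + z.2)) →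
      a = b := by
    intro a b h
    refine hdense.eq_of_inner_right (𝕜 := ℂ) ?_
    intro z
    rw [he, ← inner_conj_symm, h, inner_conj_symm]
  have hsx : ∀ ξ, star v (x ξ) = A ξ := fun ξ => ext_inner _ _ fun z => by
    rw [ContinuousLinearMap.star_eq_adjoint, ContinuousLinearMap.adjoint_inner_left, hv,
      inner_add_right, horth (ξ, z.2), add_zero, hAadj, ← mul_apply_eq_comp, hAA,
      mul_apply_eq_comp, ContinuousLinearMap.star_eq_adjoint,
      ContinuousLinearMap.adjoint_inner_right]
  have hvv : star v * v = 1 - N.starProjection := ext_e _ _ fun z => by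
    have h1 : N.starProjection (A z.1 + z.2) = z.2 := by
      refine Submodule.eq_starProjection_of_mem_orthogonal z.2.2 ?_
      rw [add_sub_cancel_right, Submodule.mem_orthogonal]
      intro u hu
      rw [← inner_conj_symm, horth (z.1, ⟨u, hu⟩), map_zero]
    simp only [mul_apply_eq_comp, hv, hsx, sub_apply, h1,
      one_apply_eq_self, add_sub_cancel_right]
  have hvN : v * N.starProjection = 0 := by
    ext u
    simpa using hv (0, ⟨N.starProjection u, Submodule.starProjection_apply_mem _ _⟩)
  refine ⟨v, hvv, ?_, ?_⟩
  · ext u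
    have hxs : ∀ ξ, star x ξ = A (star v ξ) := by
      have : x = v * A := by ext ξ; simp [hvA]
      intro ξ
      conv_lhs => rw [this, star_mul, hAs]
      rfl
    have key : (LinearMap.ker ((star x : K →L[ℂ] K) : K →ₗ[ℂ] K)).starProjection u =
        u - v (star v u) := by
      refine Submodule.eq_starProjection_of_mem_orthogonal ?_ ?_
      · rw [LinearMap.mem_ker]
        change star x _ = 0
        rw [hxs, map_sub, ← mul_apply_eq_comp (star v) v, hvv,
          sub_apply, one_apply_eq_self, sub_sub_cancel]
        exact hAker _ ((memN _).1 (Submodule.starProjection_apply_mem _ _))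
      · rw [sub_sub_cancel, Submodule.mem_orthogonal]
        intro w hw
        have hw' : star x w = 0 := hw
        have : star v w = 0 := ext_inner _ _ fun z => by
          rw [ContinuousLinearMap.star_eq_adjoint, ContinuousLinearMap.adjoint_inner_left, hv,
            ← ContinuousLinearMap.adjoint_inner_left, ← ContinuousLinearMap.star_eq_adjoint, hw',
            inner_zero_left, inner_zero_left]
        rw [← ContinuousLinearMap.adjoint_inner_left, ← ContinuousLinearMap.star_eq_adjoint, this,
          inner_zero_left]
    rw [sub_apply, key]
    simp
  · intro c h1 h2
    have hAc : Commute A c := by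
      refine Commute.cfcAbs_left h1.symm ?_
      exact h2.symm
    refine ext_e _ _ fun z => ?_
    have e1 : ∀ ξ, c (x ξ) = x (c ξ) := fun ξ => congrArg (· ξ) h1.eq
    have e2 : ∀ ξ, c (A ξ) = A (c ξ) := fun ξ => congrArg (· ξ) hAc.eq.symm
    have hm : c z.2 ∈ N := by rw [memN, ← e1, (memN _).1 z.2.2, map_zero]
    rw [mul_apply_eq_comp, mul_apply_eq_comp, hv, e1, map_add, e2]
    exact (hv (c z.1, ⟨c z.2, hm⟩)).symm

end Polar

/-! ### Matrices over `𝒜` as operators on `Hⁿ` -/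

section MatrixOperators

variable {H : Type*} [NormedAddCommGroup H] [InnerProductSpace ℂ H] [CompleteSpace H]
variable {𝒜 : VonNeumannAlgebra H} {n : Type*} [Fintype n]

theorem mem_vonNeumann_of_commute {x : H →L[ℂ] H} (hx : ∀ c ∈ 𝒜.commutant, Commute c x) :
    x ∈ 𝒜.toStarSubalgebra := by
  have : x ∈ 𝒜.commutant.commutant := VonNeumannAlgebra.mem_commutant_iff.2 hx
  rwa [VonNeumannAlgebra.commutant_commutant] at this

theorem commute_of_mem_commutant {c : H →L[ℂ] H} (hc : c ∈ 𝒜.commutant)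
    (a : 𝒜.toStarSubalgebra) : Commute c (a : H →L[ℂ] H) :=
  ((VonNeumannAlgebra.mem_commutant_iff.1 hc) a a.2).symm

theorem commutant_apply_comm {c : H →L[ℂ] H} (hc : c ∈ 𝒜.commutant)
    (a : 𝒜.toStarSubalgebra) (ξ : H) :
    c ((a : H →L[ℂ] H) ξ) = (a : H →L[ℂ] H) (c ξ) :=
  congrArg (· ξ) (commute_of_mem_commutant hc a).eq

@[simp]
theorem matrixToCLM_apply (M : Matrix n n 𝒜.toStarSubalgebra) (ξ : PiLp 2 (fun _ : n => H))
    (i : n) : matrixToCLM M ξ i = ∑ j, (M i j : H →L[ℂ] H) (ξ j) := by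
  simp [matrixToCLM]

theorem matrixToCLM_mul (M N : Matrix n n 𝒜.toStarSubalgebra) :
    matrixToCLM (M * N) = matrixToCLM M * matrixToCLM N := by
  ext ξ i
  simp only [matrixToCLM_apply, mul_apply_eq_comp, Matrix.mul_apply, map_sum,
    AddSubmonoidClass.coe_finsetSum, MulMemClass.coe_mul, sum_apply]
  exact Finset.sum_comm

theorem matrixToCLM_star (M : Matrix n n 𝒜.toStarSubalgebra) :
    matrixToCLM (star M) = star (matrixToCLM M) := by
  rw [ContinuousLinearMap.star_eq_adjoint, ContinuousLinearMap.eq_adjoint_iff]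
  intro ξ η
  simp only [PiLp.inner_apply, matrixToCLM_apply, sum_inner, inner_sum]
  rw [Finset.sum_comm]
  refine Finset.sum_congr rfl fun i _ => Finset.sum_congr rfl fun j _ => ?_
  rw [Matrix.star_apply, StarMemClass.coe_star, ContinuousLinearMap.star_eq_adjoint,
    ContinuousLinearMap.adjoint_inner_left]

theorem matrixToCLM_sub (M N : Matrix n n 𝒜.toStarSubalgebra) :
    matrixToCLM (M - N) = matrixToCLM M - matrixToCLM N := by
  ext ξ i
  simp

/-- The `j`-th coordinate embedding of `H` into `Hⁿ`. -/
def coordEmb [DecidableEq n] (j : n) : H →L[ℂ] PiLp 2 (fun _ : n => H) :=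
  (PiLp.continuousLinearEquiv 2 ℂ (fun _ : n => H)).symm.toContinuousLinearMap ∘L
    ContinuousLinearMap.single ℂ (fun _ : n => H) j

omit [CompleteSpace H] [Fintype n] in
theorem coordEmb_apply [DecidableEq n] (j : n) (ξ : H) (i : n) :
    coordEmb j ξ i = if i = j then ξ else 0 := by
  simp [coordEmb]

omit [CompleteSpace H] in
theorem sum_coordEmb [DecidableEq n] (ξ : PiLp 2 (fun _ : n => H)) :
    ∑ j, coordEmb j (ξ j) = ξ := by
  ext i
  simp [coordEmb_apply]

theorem matrixToCLM_one [DecidableEq n] :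
    matrixToCLM (1 : Matrix n n 𝒜.toStarSubalgebra) = 1 := by
  ext ξ i
  rw [matrixToCLM_apply, Finset.sum_eq_single i]
  · simp
  · intro j _ hj
    simp [Matrix.one_apply_ne hj.symm]
  · simp

theorem matrixToCLM_injective :
    Function.Injective (matrixToCLM : Matrix n n 𝒜.toStarSubalgebra → _) := by
  classical
  intro M N h
  ext i j ξ
  have := congrArg (fun T => T (coordEmb j ξ) i) h
  simpa [coordEmb_apply, apply_ite, Finset.sum_ite_eq] using this

/-- The diagonal operator on `Hⁿ` with all diagonal entries equal to `c`. -/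
def diagCLM (n : Type*) [Fintype n] (c : H →L[ℂ] H) :
    PiLp 2 (fun _ : n => H) →L[ℂ] PiLp 2 (fun _ : n => H) :=
  (PiLp.continuousLinearEquiv 2 ℂ (fun _ : n => H)).symm.toContinuousLinearMap ∘L
    ContinuousLinearMap.pi fun i => c ∘L PiLp.proj 2 (fun _ : n => H) i

omit [CompleteSpace H] in
@[simp]
theorem diagCLM_apply (c : H →L[ℂ] H) (ξ : PiLp 2 (fun _ : n => H)) (i : n) :
    diagCLM n c ξ i = c (ξ i) := by
  simp [diagCLM]

theorem diagCLM_star (c : H →L[ℂ] H) : star (diagCLM n c) = diagCLM n (star c) := by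
  symm
  rw [ContinuousLinearMap.star_eq_adjoint (diagCLM n c), ContinuousLinearMap.eq_adjoint_iff]
  intro ξ η
  simp only [PiLp.inner_apply, diagCLM_apply, ContinuousLinearMap.star_eq_adjoint,
    ContinuousLinearMap.adjoint_inner_left]

theorem commute_diagCLM_matrixToCLM {c : H →L[ℂ] H} (hc : c ∈ 𝒜.commutant)
    (M : Matrix n n 𝒜.toStarSubalgebra) : Commute (diagCLM n c) (matrixToCLM M) := by
  ext ξ i
  simp [commutant_apply_comm hc]

/-- The compression of `T` to a pair of coordinates commutes with `𝒜'`, since diagonal operators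
intertwine the coordinate embeddings. By the double commutant property it is an element of `𝒜`. -/
theorem exists_matrixToCLM_eq [DecidableEq n]
    {T : PiLp 2 (fun _ : n => H) →L[ℂ] PiLp 2 (fun _ : n => H)}
    (hT : ∀ c ∈ 𝒜.commutant, Commute (diagCLM n c) T) :
    ∃ M : Matrix n n 𝒜.toStarSubalgebra, matrixToCLM M = T := by
  have hmem : ∀ i j, PiLp.proj 2 (fun _ : n => H) i ∘L T ∘L coordEmb j ∈ 𝒜.toStarSubalgebra := by
    refine fun i j => mem_vonNeumann_of_commute fun c hc => ?_
    ext ξ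
    have h1 : diagCLM n c (coordEmb j ξ) = coordEmb j (c ξ) := by
      ext k
      by_cases hk : k = j <;> simp [coordEmb_apply, hk]
    have h2 := congrArg (fun S => S (coordEmb j ξ) i) (hT c hc).eq
    simpa [h1] using h2
  refine ⟨Matrix.of fun i j => ⟨_, hmem i j⟩, ?_⟩
  ext ξ i
  rw [matrixToCLM_apply]
  conv_rhs => rw [← sum_coordEmb ξ]
  simp

theorem commute_starProjection_of_invariant {K : Type*} [NormedAddCommGroup K]
    [InnerProductSpace ℂ K] [CompleteSpace K] {V : Submodule ℂ K} [V.HasOrthogonalProjection]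
    {c : K →L[ℂ] K} (h1 : ∀ ξ ∈ V, c ξ ∈ V) (h2 : ∀ ξ ∈ V, star c ξ ∈ V) :
    Commute c V.starProjection := by
  ext u
  simp only [mul_apply_eq_comp]
  symm
  refine Submodule.eq_starProjection_of_mem_orthogonal
    (h1 _ (Submodule.starProjection_apply_mem _ _)) ?_
  rw [← map_sub, Submodule.mem_orthogonal]
  intro w hw
  rw [← ContinuousLinearMap.adjoint_inner_left, ← ContinuousLinearMap.star_eq_adjoint]
  exact (Submodule.mem_orthogonal _ _).1 (Submodule.sub_starProjection_mem_orthogonal u) _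
    (h2 w hw)

/-- The projection onto a closed subspace of `Hⁿ` invariant under the commutant is a matrix
over `𝒜`. -/
theorem exists_matrixToCLM_eq_starProjection [DecidableEq n]
    {V : Submodule ℂ (PiLp 2 (fun _ : n => H))} [V.HasOrthogonalProjection]
    (hV : ∀ c ∈ 𝒜.commutant, ∀ ξ ∈ V, diagCLM n c ξ ∈ V) :
    ∃ M : Matrix n n 𝒜.toStarSubalgebra, matrixToCLM M = V.starProjection :=
  exists_matrixToCLM_eq fun c hc => commute_starProjection_of_invariant (hV c hc)
    (by rw [diagCLM_star]; exact hV _ (star_mem hc))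

theorem exists_matrixToCLM_eq_starProjection_ker [DecidableEq n]
    (M : Matrix n n 𝒜.toStarSubalgebra) : ∃ p : Matrix n n 𝒜.toStarSubalgebra,
      matrixToCLM p = (matrixToCLM M).ker.starProjection := by
  refine exists_matrixToCLM_eq_starProjection fun c hc ξ hξ => ?_
  have h : matrixToCLM M ξ = 0 := hξ
  have := congrArg (fun S => S ξ) (commute_diagCLM_matrixToCLM hc M).eq
  simp only [mul_apply_eq_comp, h, map_zero] at this
  exact this.symm

theorem starProjection_mem_of_invariant {V : Submodule ℂ H} [V.HasOrthogonalProjection]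
    (hV : ∀ c ∈ 𝒜.commutant, ∀ ξ ∈ V, c ξ ∈ V) : V.starProjection ∈ 𝒜.toStarSubalgebra :=
  mem_vonNeumann_of_commute fun c hc => commute_starProjection_of_invariant (hV c hc)
    (hV _ (star_mem hc))

theorem starProjection_ker_mem (a : 𝒜.toStarSubalgebra) :
    (a : H →L[ℂ] H).ker.starProjection ∈ 𝒜.toStarSubalgebra := by
  refine starProjection_mem_of_invariant fun c hc ξ hξ => ?_
  have h : (a : H →L[ℂ] H) ξ = 0 := hξ
  change (a : H →L[ℂ] H) (c ξ) = 0
  rw [← commutant_apply_comm hc, h, map_zero]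

/-- The polar decomposition in the matrix algebra over `𝒜`. -/
theorem exists_matrix_polar [DecidableEq n] (x : Matrix n n 𝒜.toStarSubalgebra) :
    ∃ v : Matrix n n 𝒜.toStarSubalgebra,
      matrixToCLM (star v * v) =
        1 - (matrixToCLM x).ker.starProjection ∧
      matrixToCLM (v * star v) =
        1 - (matrixToCLM (star x)).ker.starProjection := by
  obtain ⟨v, h1, h2, h3⟩ := exists_polar_partialIsometry (matrixToCLM x)
  obtain ⟨w, rfl⟩ := exists_matrixToCLM_eq (T := v) (𝒜 := 𝒜) fun c hc =>
    h3 _ (commute_diagCLM_matrixToCLM hc x)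
      (by rw [diagCLM_star]; exact commute_diagCLM_matrixToCLM (star_mem hc) x)
  refine ⟨w, ?_, ?_⟩
  · rw [matrixToCLM_mul, matrixToCLM_star, h1]
  · rw [matrixToCLM_mul, matrixToCLM_star, h2]
    simp only [matrixToCLM_star]

/-- The unnormalized trace on matrices is tracial. -/
theorem sum_trace_mul_comm {τ : 𝒜.toStarSubalgebra →ₗ[ℂ] ℂ}
    (hτ : IsFaithfulNormalTraceState 𝒜 τ) (M N : Matrix n n 𝒜.toStarSubalgebra) :
    ∑ i, τ ((M * N) i i) = ∑ i, τ ((N * M) i i) := by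
  simp only [Matrix.mul_apply, map_sum]
  rw [Finset.sum_comm]
  exact Finset.sum_congr rfl fun i _ => Finset.sum_congr rfl fun j _ => hτ.tracial _ _

theorem eq_zero_of_sum_trace_star_mul_self {τ : 𝒜.toStarSubalgebra →ₗ[ℂ] ℂ}
    (hτ : IsFaithfulNormalTraceState 𝒜 τ) {M : Matrix n n 𝒜.toStarSubalgebra}
    (h : ∑ i, τ ((star M * M) i i) = 0) : M = 0 := by
  simp only [Matrix.mul_apply, map_sum, Matrix.star_apply] at h
  have h1 : ∀ i j, 0 ≤ τ (star (M j i) * M j i) := fun i j => hτ.nonneg _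
  rw [Finset.sum_eq_zero_iff_of_nonneg fun i _ => Finset.sum_nonneg fun j _ => h1 i j] at h
  ext1 j i
  have h2 := h i (Finset.mem_univ _)
  rw [Finset.sum_eq_zero_iff_of_nonneg fun j _ => h1 i j] at h2
  exact hτ.faithful _ (h2 j (Finset.mem_univ _))

end MatrixOperators

/-! ### Finiteness and the Ore conditions -/

section Finite

variable {H : Type*} [NormedAddCommGroup H] [InnerProductSpace ℂ H] [CompleteSpace H]
variable {𝒜 : VonNeumannAlgebra H} {τ : 𝒜.toStarSubalgebra →ₗ[ℂ] ℂ}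

/-- The elements of `𝒜` that are injective as operators on `H`. -/
def injectiveElements (𝒜 : VonNeumannAlgebra H) : Submonoid 𝒜.toStarSubalgebra where
  carrier := {a | Function.Injective (a : H →L[ℂ] H)}
  one_mem' := fun _ _ h => h
  mul_mem' := fun ha hb => ha.comp hb

theorem mem_injectiveElements {a : 𝒜.toStarSubalgebra} :
    a ∈ injectiveElements 𝒜 ↔ ∀ ξ, (a : H →L[ℂ] H) ξ = 0 → ξ = 0 :=
  injective_iff_map_eq_zero _

/-- `1 - v v*` is a projection of trace `τ(1) - τ(v* v) = 0`, and `τ` is faithful. -/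
theorem mul_star_eq_one_of_star_mul_eq_one (hτ : IsFaithfulNormalTraceState 𝒜 τ)
    {v : 𝒜.toStarSubalgebra} (h : star v * v = 1) : v * star v = 1 := by
  have h0 : star (1 - v * star v) * (1 - v * star v) = 1 - v * star v := by
    have : v * star v * (v * star v) = v * star v := by
      rw [mul_assoc, ← mul_assoc (star v), h, one_mul]
    simp only [star_sub, star_one, star_mul, star_star, mul_sub, sub_mul, one_mul, mul_one, this]
    abel
  have h1 : τ (1 - v * star v) = 0 := by
    rw [map_sub, hτ.tracial, h, sub_self]
  rw [← h0] at h1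
  exact (sub_eq_zero.1 (hτ.faithful _ h1)).symm

/-- The polar part of an injective element is an isometry, hence unitary by finiteness, so the
kernel of the adjoint vanishes. -/
theorem star_mem_injectiveElements (hτ : IsFaithfulNormalTraceState 𝒜 τ)
    {a : 𝒜.toStarSubalgebra} (ha : a ∈ injectiveElements 𝒜) : star a ∈ injectiveElements 𝒜 := by
  obtain ⟨v, h1, h2, h3⟩ := exists_polar_partialIsometry (a : H →L[ℂ] H)
  have hv : v ∈ 𝒜.toStarSubalgebra := mem_vonNeumann_of_commute fun c hc =>
    h3 c (commute_of_mem_commutant hc a) (commute_of_mem_commutant (star_mem hc) a)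
  have hone : star (⟨v, hv⟩ : 𝒜.toStarSubalgebra) * ⟨v, hv⟩ = 1 := by
    apply Subtype.ext
    change star v * v = 1
    rw [h1]
    ext ξ
    have : (a : H →L[ℂ] H).ker.starProjection ξ = 0 := by
      refine ha (Eq.trans ?_ (map_zero _).symm)
      exact LinearMap.mem_ker.1 (Submodule.starProjection_apply_mem (a : H →L[ℂ] H).ker ξ)
    simp [this]
  have hone' : v * star v = 1 :=
    congrArg Subtype.val (mul_star_eq_one_of_star_mul_eq_one hτ hone)
  rw [mem_injectiveElements]
  intro ξ hξ
  have h4 : (star (a : H →L[ℂ] H)).ker.starProjection = 0 := by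
    rw [hone'] at h2
    exact sub_eq_self.1 h2.symm
  rw [← Submodule.starProjection_eq_self_iff.2 (show ξ ∈ (star (a : H →L[ℂ] H)).ker from hξ), h4]
  rfl

theorem denseRange_of_mem_injectiveElements (hτ : IsFaithfulNormalTraceState 𝒜 τ)
    {a : 𝒜.toStarSubalgebra} (ha : a ∈ injectiveElements 𝒜) : DenseRange (a : H →L[ℂ] H) := by
  have h := star_mem_injectiveElements hτ ha
  change DenseRange ((a : H →L[ℂ] H) : H →ₗ[ℂ] H)
  rw [DenseRange, ← LinearMap.coe_range, Submodule.dense_iff_topologicalClosure_eq_top,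
    Submodule.topologicalClosure_eq_top_iff, Submodule.eq_bot_iff]
  intro u hu
  refine mem_injectiveElements.1 h u ?_
  change star (a : H →L[ℂ] H) u = 0
  rw [← inner_self_eq_zero (𝕜 := ℂ), ContinuousLinearMap.star_eq_adjoint,
    ContinuousLinearMap.adjoint_inner_right]
  exact (Submodule.mem_orthogonal _ _).1 hu _ ⟨_, rfl⟩

/-- The right Ore condition: a common right multiple is read off from the projection onto
`ker [a, -d] ⊆ H²`, which has trace `1` and is therefore equivalent to a copy of `H`. -/
theorem exists_right_ore (hτ : IsFaithfulNormalTraceState 𝒜 τ) (a : 𝒜.toStarSubalgebra)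
    {d : 𝒜.toStarSubalgebra} (hd : d ∈ injectiveElements 𝒜) :
    ∃ t ∈ injectiveElements 𝒜, ∃ b, a * t = d * b := by
  have hd' := star_mem_injectiveElements hτ hd
  rw [mem_injectiveElements] at hd hd'
  set x : Matrix (Fin 2) (Fin 2) 𝒜.toStarSubalgebra := !![a, -d; 0, 0]
  set e : Matrix (Fin 2) (Fin 2) 𝒜.toStarSubalgebra := !![1, 0; 0, 0]
  set e' : Matrix (Fin 2) (Fin 2) 𝒜.toStarSubalgebra := !![0, 0; 0, 1]
  have he1 : 1 - e' = e := by
    ext i j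
    fin_cases i <;> fin_cases j <;> simp [e, e']
  have he's : star e' = e' := by
    ext i j
    fin_cases i <;> fin_cases j <;> simp [e', Matrix.star_apply]
  have he'e' : e' * e' = e' := by
    ext i j
    fin_cases i <;> fin_cases j <;> simp [e', Matrix.mul_apply]
  have hes : star e = e := by rw [← he1, star_sub, star_one, he's]
  have htr1 : ∑ i, τ ((1 : Matrix (Fin 2) (Fin 2) 𝒜.toStarSubalgebra) i i) = 2 := by
    simp [hτ.map_one]
  have htre : ∑ i, τ (e i i) = 1 := by simp [e, hτ.map_one]
  have htre' : ∑ i, τ (e' i i) = 1 := by simp [e', hτ.map_one]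
  have hxapp : ∀ ξ : PiLp 2 (fun _ : Fin 2 => H), matrixToCLM x ξ = 0 ↔
      (a : H →L[ℂ] H) (ξ 0) = (d : H →L[ℂ] H) (ξ 1) := by
    intro ξ
    constructor
    · intro h
      have := congrArg (fun z => z 0) h
      simp [x, ← sub_eq_add_neg] at this
      exact sub_eq_zero.1 this
    · intro h
      ext i
      fin_cases i <;> simp [x, h]
  obtain ⟨k, hk⟩ := exists_matrixToCLM_eq_starProjection_ker x
  have hks : star k = k := matrixToCLM_injective (by
    rw [matrixToCLM_star, hk]; exact isStarProjection_starProjection.isSelfAdjoint)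
  have hxk : x * k = 0 := matrixToCLM_injective (by
    rw [matrixToCLM_mul, hk]
    ext1 ξ
    rw [mul_apply_eq_comp, show matrixToCLM x _ = 0 from
      LinearMap.mem_ker.1 (Submodule.starProjection_apply_mem (matrixToCLM x).ker ξ)]
    ext i
    simp)
  -- As `d*` is injective, `ker x*` is the second coordinate copy of `H`. So `1 - k` is equivalent
  -- to `e`, and `k` has unnormalized trace `2 - 1 = 1`.
  obtain ⟨v, hv1, hv2⟩ := exists_matrix_polar x
  have hvv : star v * v = 1 - k := matrixToCLM_injective (by
    rw [hv1, matrixToCLM_sub, matrixToCLM_one, hk])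
  have hvv' : v * star v = e := by
    rw [← he1]
    apply matrixToCLM_injective
    rw [hv2, matrixToCLM_sub, matrixToCLM_one]
    congr 1
    ext1 u
    have hstar : ∀ w, matrixToCLM (star x) w = 0 → w 0 = 0 := by
      intro w hw
      have := congrArg (fun z => z 1) hw
      simp [x, Matrix.star_apply] at this
      exact hd' _ this
    refine Submodule.eq_starProjection_of_mem_orthogonal ?_ ?_
    · change matrixToCLM (star x) _ = 0
      ext i
      fin_cases i <;> simp [x, e', Matrix.star_apply]
    · rw [Submodule.mem_orthogonal]
      intro w hw
      simp [PiLp.inner_apply, hstar w hw, e']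
  have htrk : ∑ i, τ (k i i) = 1 := by
    have h1 := sum_trace_mul_comm hτ (star v) v
    rw [hvv, hvv', htre] at h1
    simp only [Matrix.sub_apply, map_sub, Finset.sum_sub_distrib] at h1
    rw [htr1] at h1
    linear_combination -h1
  -- The first coordinate is injective on `ker x`: if `ξ 0 = 0`, then `d (ξ 1) = 0`. Hence `w* w =
  -- k`.
  obtain ⟨w, hw1, hw2⟩ := exists_matrix_polar (e * k)
  have hww : star w * w = k := by
    apply matrixToCLM_injective
    have hkk : ((matrixToCLM (e * k)).ker).starProjection = 1 - matrixToCLM k := by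
      ext1 u
      refine Submodule.eq_starProjection_of_mem_orthogonal ?_ ?_
      · change matrixToCLM (e * k) _ = 0
        have : k * (1 - k) = 0 := by
          apply matrixToCLM_injective
          rw [matrixToCLM_mul, matrixToCLM_sub, matrixToCLM_one, hk, mul_sub, mul_one,
            isStarProjection_starProjection.isIdempotentElem.eq, sub_self]
          ext ξ i
          simp
        rw [← matrixToCLM_one (𝒜 := 𝒜), ← matrixToCLM_sub, ← mul_apply_eq_comp, ← matrixToCLM_mul,
          mul_assoc, this, mul_zero]
        ext i
        simp
      · rw [Submodule.mem_orthogonal]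
        intro z hz
        have hz : matrixToCLM (e * k) z = 0 := hz
        have hkz : matrixToCLM k z = 0 := by
          have h1 : matrixToCLM x (matrixToCLM k z) = 0 := by
            rw [← mul_apply_eq_comp, ← matrixToCLM_mul, hxk]
            ext i
            simp
          rw [hxapp] at h1
          have h2 : matrixToCLM k z 0 = 0 := by
            rw [matrixToCLM_mul, mul_apply_eq_comp] at hz
            have := congrArg (fun z => z 0) hz
            simpa only [matrixToCLM_apply e, e, Matrix.of_apply, Matrix.cons_val', Fin.sum_univ_two,
              Matrix.cons_val_zero, Matrix.cons_val_one, OneMemClass.coe_one, one_apply_eq_self,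
              ZeroMemClass.coe_zero, zero_apply, add_zero, PiLp.zero_apply,
              Matrix.cons_val_fin_one] using this
          rw [h2, map_zero] at h1
          ext i
          fin_cases i
          · exact h2
          · exact hd _ h1.symm
        rw [sub_apply, one_apply_eq_self, sub_sub_cancel,
          ← ContinuousLinearMap.adjoint_inner_left, ← ContinuousLinearMap.star_eq_adjoint,
          ← matrixToCLM_star, hks, hkz, inner_zero_left]
    rw [hw1, hkk, sub_sub_cancel]
  -- The range projection `1 - f` lies below `e = 1 - e'`, and both have trace `1`. So `f - e'` is a
  -- projection of trace zero.
  have hww' : w * star w = e := by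
    obtain ⟨f, hf⟩ := exists_matrixToCLM_eq_starProjection_ker (star (e * k))
    have hfs : star f = f := matrixToCLM_injective (by
      rw [matrixToCLM_star, hf]; exact isStarProjection_starProjection.isSelfAdjoint)
    have hff : f * f = f := matrixToCLM_injective (by
      rw [matrixToCLM_mul, hf]; exact isStarProjection_starProjection.isIdempotentElem)
    have hwf : w * star w = 1 - f := matrixToCLM_injective (by
      rw [hw2, matrixToCLM_sub, matrixToCLM_one, hf])
    have hfe : f * e' = e' := by
      apply matrixToCLM_injective
      ext1 u
      rw [matrixToCLM_mul, mul_apply_eq_comp, hf, Submodule.starProjection_eq_self_iff]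
      change matrixToCLM (star (e * k)) _ = 0
      rw [← mul_apply_eq_comp, ← matrixToCLM_mul, star_mul, hes, mul_assoc]
      have : e * e' = 0 := by
        ext i j
        fin_cases i <;> fin_cases j <;> simp [e, e', Matrix.mul_apply]
      rw [this, mul_zero]
      ext i
      simp
    have hef : e' * f = e' := by
      have := congrArg star hfe
      rwa [star_mul, hfs, he's] at this
    have h1 : star (f - e') * (f - e') = f - e' := by
      rw [star_sub, hfs, he's, sub_mul, mul_sub, mul_sub, hff, hfe, hef, he'e']
      abel
    have h2 : ∑ i, τ ((f - e') i i) = 0 := by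
      have h3 := sum_trace_mul_comm hτ (star w) w
      rw [hww, hwf, htrk] at h3
      simp only [Matrix.sub_apply, map_sub, Finset.sum_sub_distrib] at h3 ⊢
      rw [htr1] at h3
      rw [htre']
      linear_combination h3
    rw [← h1] at h2
    rw [hwf, sub_eq_zero.1 (eq_zero_of_sum_trace_star_mul_self hτ h2), he1]
  -- The first column of `w*` takes values in `ker x`; its two entries are the desired multipliers.
  have hab : a * star (w 0 0) = d * star (w 0 1) := by
    have h1 : x * star w * e = 0 := by
      rw [← hww', ← mul_assoc, mul_assoc x, hww, hxk, zero_mul]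
    have h2 := congrFun (congrFun h1 0) 0
    simp only [Matrix.mul_apply, Fin.sum_univ_two, Matrix.star_apply] at h2
    simp [x, e] at h2
    rwa [← sub_eq_add_neg, sub_eq_zero] at h2
  refine ⟨star (w 0 0), ?_, star (w 0 1), hab⟩
  rw [mem_injectiveElements]
  intro ξ hξ
  have h1 : ((star (w 0 1) : 𝒜.toStarSubalgebra) : H →L[ℂ] H) ξ = 0 := by
    apply hd
    have := congrArg (fun y : 𝒜.toStarSubalgebra => (y : H →L[ℂ] H) ξ) hab
    simp only [MulMemClass.coe_mul, mul_apply_eq_comp] at this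
    rw [← this, hξ, map_zero]
  have h2 : w 0 0 * star (w 0 0) + w 0 1 * star (w 0 1) = 1 := by
    have := congrFun (congrFun hww' 0) 0
    simpa [Matrix.mul_apply, Fin.sum_univ_two, Matrix.star_apply, e] using this
  have h3 := congrArg (fun y : 𝒜.toStarSubalgebra => (y : H →L[ℂ] H) ξ) h2
  simp only [AddMemClass.coe_add, MulMemClass.coe_mul, add_apply, mul_apply_eq_comp] at h3
  rw [hξ, h1, map_zero, map_zero, add_zero] at h3
  exact h3.symm

theorem exists_left_ore (hτ : IsFaithfulNormalTraceState 𝒜 τ) (a : 𝒜.toStarSubalgebra)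
    {d : 𝒜.toStarSubalgebra} (hd : d ∈ injectiveElements 𝒜) :
    ∃ t ∈ injectiveElements 𝒜, ∃ b, t * a = b * d := by
  obtain ⟨t, ht, b, h⟩ := exists_right_ore hτ (star a) (star_mem_injectiveElements hτ hd)
  refine ⟨star t, star_mem_injectiveElements hτ ht, star b, ?_⟩
  simpa using congrArg star h

theorem mul_right_cancel_of_mem_injectiveElements (hτ : IsFaithfulNormalTraceState 𝒜 τ)
    {a b d : 𝒜.toStarSubalgebra} (hd : d ∈ injectiveElements 𝒜) (h : a * d = b * d) : a = b := by
  apply Subtype.ext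
  ext ξ
  refine congrFun ((denseRange_of_mem_injectiveElements hτ hd).equalizer
    (a : H →L[ℂ] H).continuous (b : H →L[ℂ] H).continuous (funext fun z => ?_)) ξ
  exact congrArg (fun y : 𝒜.toStarSubalgebra => (y : H →L[ℂ] H) z) h

end Finite

/-! ### The ring of fractions and the module of formal vectors -/

section Fractions

universe u

variable {H : Type u} [NormedAddCommGroup H] [InnerProductSpace ℂ H] [CompleteSpace H]

/-- A ring of fractions `Q` of `𝒜` with respect to the injective elements, together with a
`Q`-module `E` of formal vectors that contains `H`.  It plays the role of the algebra of operators
affiliated with `𝒜`: the element `q` stands for the closed operator with graph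
`{(ξ, η) | q • ξ = η}`. -/
structure FractionModel (𝒜 : VonNeumannAlgebra H) (Q E : Type*) [Ring Q] [Algebra ℂ Q]
    [AddCommGroup E] [Module Q E] where
  num : 𝒜.toStarSubalgebra →ₐ[ℂ] Q
  vec : H →+ E
  num_injective : Function.Injective num
  vec_injective : Function.Injective vec
  vec_apply : ∀ (a : 𝒜.toStarSubalgebra) ξ, vec ((a : H →L[ℂ] H) ξ) = num a • vec ξ
  isUnit_num : ∀ s ∈ injectiveElements 𝒜, IsUnit (num s)
  exists_left : ∀ q, ∃ s ∈ injectiveElements 𝒜, ∃ a, num s * q = num a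
  exists_right : ∀ q, ∃ s ∈ injectiveElements 𝒜, ∃ a, q * num s = num a
  star_mem : ∀ s ∈ injectiveElements 𝒜, star s ∈ injectiveElements 𝒜
  denseRange : ∀ s ∈ injectiveElements 𝒜, DenseRange (s : H →L[ℂ] H)

theorem exists_fractionModel {𝒜 : VonNeumannAlgebra H} {τ : 𝒜.toStarSubalgebra →ₗ[ℂ] ℂ}
    (hτ : IsFaithfulNormalTraceState 𝒜 τ) :
    ∃ (Q E : Type u) (_ : Ring Q) (_ : Algebra ℂ Q) (_ : AddCommGroup E) (_ : Module Q E),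
      Nonempty (FractionModel 𝒜 Q E) := by
  have hore : Nonempty (OreLocalization.OreSet (injectiveElements 𝒜)) := by
    rw [OreLocalization.nonempty_oreSet_iff]
    -- Injective elements have dense range, so they can be cancelled on the right and the witness
    -- `1` suffices.
    refine ⟨fun a b s h => ⟨1, ?_⟩, fun a s => ?_⟩
    · rw [mul_right_cancel_of_mem_injectiveElements hτ s.2 h]
    · obtain ⟨t, ht, b, h⟩ := exists_left_ore hτ a s.2
      exact ⟨b, ⟨t, ht⟩, h⟩
  obtain ⟨_⟩ := hore
  let S := injectiveElements 𝒜
  have hcancel : ∀ s ∈ S, ∀ a b : 𝒜.toStarSubalgebra, s * a = s * b → a = b := by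
    intro s hs a b h
    apply Subtype.ext
    ext ξ
    exact hs (congrArg (fun y : 𝒜.toStarSubalgebra => (y : H →L[ℂ] H) ξ) h)
  let j : 𝒜.toStarSubalgebra →ₐ[ℂ] OreLocalization S 𝒜.toStarSubalgebra :=
    { OreLocalization.numeratorRingHom with
      commutes' := fun c => by
        rfl }
  have hj : ∀ a, j a = OreLocalization.oreDiv a 1 := fun a => rfl
  have hleft : ∀ (s : S) (a : 𝒜.toStarSubalgebra), j s * OreLocalization.oreDiv a s = j a :=
    fun s a => OreLocalization.mul_cancel
  refine ⟨OreLocalization S 𝒜.toStarSubalgebra, OreLocalization S H, inferInstance, inferInstance,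
    inferInstance, inferInstance, ⟨
    { num := j
      vec :=
        { toFun := fun ξ => OreLocalization.oreDiv ξ 1
          map_zero' := OreLocalization.zero_oreDiv _
          map_add' := fun ξ η => OreLocalization.add_oreDiv.symm }
      num_injective := fun a b h => ?_
      vec_injective := fun ξ η h => ?_
      vec_apply := fun a ξ => OreLocalization.smul_div_one.symm
      isUnit_num := fun s hs => OreLocalization.numerator_isUnit (⟨s, hs⟩ : S)
      exists_left := fun q => ?_
      exists_right := fun q => ?_
      star_mem := fun s hs => star_mem_injectiveElements hτ hs
      denseRange := fun s hs => denseRange_of_mem_injectiveElements hτ hs }⟩⟩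
  · rw [hj, hj, OreLocalization.oreDiv_eq_iff] at h
    obtain ⟨u, v, h1, h2⟩ := h
    simp only [OneMemClass.coe_one, mul_one] at h2
    rw [← h2] at h1
    exact (hcancel u u.2 b a h1).symm
  · change OreLocalization.oreDiv ξ (1 : S) = OreLocalization.oreDiv η (1 : S) at h
    rw [OreLocalization.oreDiv_eq_iff] at h
    obtain ⟨u, v, h1, h2⟩ := h
    simp only [OneMemClass.coe_one, mul_one] at h2
    rw [← h2] at h1
    exact (u.2 h1).symm
  · induction q using OreLocalization.ind with | _ a s
    exact ⟨s, s.2, a, hleft s a⟩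
  · induction q using OreLocalization.ind with | _ a s
    obtain ⟨t, ht, b, h⟩ := exists_right_ore hτ a s.2
    refine ⟨t, ht, b, ?_⟩
    refine (OreLocalization.numerator_isUnit s).mul_left_cancel ?_
    change j s * (_ * j t) = j s * j b
    rw [← mul_assoc, hleft, ← map_mul, ← map_mul, h]

end Fractions

/-! ### Common denominators and columns over `𝒜` -/

section Core

variable {H : Type*} [NormedAddCommGroup H] [InnerProductSpace ℂ H] [CompleteSpace H]
variable {𝒜 : VonNeumannAlgebra H}

/-- A closed subspace of `Hⁿ` invariant under the commutant that contains no nonzero column of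
elements of `𝒜` is trivial. -/
theorem eq_bot_of_columns {n : Type*} [Fintype n] {V : Submodule ℂ (PiLp 2 (fun _ : n => H))}
    (hcl : IsClosed (V : Set (PiLp 2 (fun _ : n => H))))
    (hinv : ∀ c ∈ 𝒜.commutant, ∀ ξ ∈ V, diagCLM n c ξ ∈ V)
    (hcol : ∀ c : n → 𝒜.toStarSubalgebra,
      (∀ ξ : H, WithLp.toLp 2 (fun k => (c k : H →L[ℂ] H) ξ) ∈ V) → ∀ k, c k = 0) : V = ⊥ := by
  classical
  have : CompleteSpace V := hcl.completeSpace_coe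
  obtain ⟨p, hp⟩ := exists_matrixToCLM_eq_starProjection hinv
  have hp0 : p = 0 := by
    ext1 i k
    -- Every column of the matrix of the projection onto `V` takes values in `V`.
    refine hcol (fun i => p i k) (fun ξ => ?_) i
    convert Submodule.starProjection_apply_mem V (coordEmb k ξ) using 1
    rw [← hp]
    ext i
    rw [matrixToCLM_apply, Finset.sum_eq_single k]
    · simp [coordEmb_apply]
    · intro j _ hj
      simp [coordEmb_apply, hj]
    · simp
  rw [Submodule.eq_bot_iff]
  intro u hu
  rw [← Submodule.starProjection_eq_self_iff.2 hu, ← hp, hp0]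
  ext i
  simp

namespace FractionModel

variable {Q E : Type*} [Ring Q] [Algebra ℂ Q] [AddCommGroup E] [Module Q E]
variable (F : FractionModel 𝒜 Q E)

theorem smul_cancel {s : 𝒜.toStarSubalgebra} (hs : s ∈ injectiveElements 𝒜) {u v : E} :
    F.num s • u = F.num s • v ↔ u = v :=
  (F.isUnit_num s hs).smul_left_cancel

include F in
theorem eq_zero_of_mul_eq_zero {a s : 𝒜.toStarSubalgebra} (hs : s ∈ injectiveElements 𝒜)
    (h : a * s = 0) : a = 0 := by
  apply F.num_injective
  rw [map_zero, ← (F.isUnit_num s hs).mul_left_eq_zero, ← map_mul, h, map_zero]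

theorem exists_common_left {κ : Type*} [Finite κ] (z : κ → Q) :
    ∃ s ∈ injectiveElements 𝒜, ∀ k, ∃ a, F.num s * z k = F.num a := by
  classical
  have := Fintype.ofFinite κ
  suffices ∀ t : Finset κ, ∃ s ∈ injectiveElements 𝒜, ∀ k ∈ t, ∃ a, F.num s * z k = F.num a by
    simpa using this Finset.univ
  intro t
  induction t using Finset.induction_on with
  | empty => exact ⟨1, one_mem _, by simp⟩
  | insert k t _ ih =>
    obtain ⟨s, hs, h⟩ := ih
    obtain ⟨r, hr, a, ha⟩ := F.exists_left (F.num s * z k)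
    refine ⟨r * s, mul_mem hr hs, fun l hl => ?_⟩
    rw [map_mul, mul_assoc]
    obtain rfl | hl := Finset.mem_insert.1 hl
    · exact ⟨a, ha⟩
    · obtain ⟨b, hb⟩ := h l hl
      exact ⟨r * b, by rw [hb, map_mul]⟩

theorem exists_common_right {κ : Type*} [Finite κ] (z : κ → Q) :
    ∃ s ∈ injectiveElements 𝒜, ∀ k, ∃ a, z k * F.num s = F.num a := by
  classical
  have := Fintype.ofFinite κ
  suffices ∀ t : Finset κ, ∃ s ∈ injectiveElements 𝒜, ∀ k ∈ t, ∃ a, z k * F.num s = F.num a by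
    simpa using this Finset.univ
  intro t
  induction t using Finset.induction_on with
  | empty => exact ⟨1, one_mem _, by simp⟩
  | insert k t _ ih =>
    obtain ⟨s, hs, h⟩ := ih
    obtain ⟨r, hr, a, ha⟩ := F.exists_right (z k * F.num s)
    refine ⟨s * r, mul_mem hs hr, fun l hl => ?_⟩
    rw [map_mul, ← mul_assoc]
    obtain rfl | hl := Finset.mem_insert.1 hl
    · exact ⟨a, ha⟩
    · obtain ⟨b, hb⟩ := h l hl
      exact ⟨b * r, by rw [hb, map_mul]⟩

variable {ι : Type*} [Fintype ι]

theorem sum_vec_apply (a : ι → 𝒜.toStarSubalgebra) (ξ : ι → H) :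
    F.vec (∑ j, (a j : H →L[ℂ] H) (ξ j)) = ∑ j, F.num (a j) • F.vec (ξ j) := by
  simp [F.vec_apply]

include F in
/-- If `N s = d b` with injective `s`, `d`, then every column `(x, y)` in the graph `N x = d y` that
is orthogonal to the graph `{(s ω, b ω)}` vanishes. -/
theorem column_eq_zero {N b : Matrix ι ι 𝒜.toStarSubalgebra} {d s : 𝒜.toStarSubalgebra}
    (hd : d ∈ injectiveElements 𝒜) (hs : s ∈ injectiveElements 𝒜)
    (hN : ∀ i j, N i j * s = d * b i j) {x y : ι → 𝒜.toStarSubalgebra}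
    (h1 : ∀ i, ∑ j, N i j * x j = d * y i)
    (h2 : ∀ i, star s * x i + ∑ k, star (b k i) * y k = 0) : x = 0 ∧ y = 0 := by
  have hsu := F.isUnit_num s hs
  have hdu := F.isUnit_num d hd
  -- Put `z = s⁻¹ x`. Since `b = d⁻¹ N s`, the graph relation reads `y = b z`, so `(x, y)` is
  -- formally of the form `(s z, b z)`. A common right denominator `t` brings `z` back into `𝒜`.
  have hz : ∀ i, ∃ z, F.num s * z = F.num (x i) := fun i =>
    ⟨hsu.unit⁻¹ * F.num (x i), by rw [← mul_assoc, IsUnit.mul_val_inv, one_mul]⟩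
  choose z hz using hz
  have hy : ∀ i, F.num (y i) = ∑ j, F.num (b i j) * z j := fun i => by
    apply hdu.mul_left_cancel
    rw [Finset.mul_sum, ← map_mul, ← h1, map_sum]
    refine Finset.sum_congr rfl fun j _ => ?_
    rw [← mul_assoc, ← map_mul, ← hN, map_mul, map_mul, mul_assoc, hz]
  obtain ⟨t, ht, hw⟩ := F.exists_common_right z
  choose w hw using hw
  have hx' : ∀ i, x i * t = s * w i := fun i => F.num_injective (by
    rw [map_mul, map_mul, ← hz, mul_assoc, hw])
  have hy' : ∀ i, y i * t = ∑ j, b i j * w j := fun i => F.num_injective (by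
    rw [map_mul, hy, map_sum, Finset.sum_mul]
    exact Finset.sum_congr rfl fun j _ => by rw [map_mul, mul_assoc, hw])
  have h3 : ∀ i, star s * (s * w i) + ∑ k, star (b k i) * ∑ j, b k j * w j = 0 := fun i => by
    have := congrArg (· * t) (h2 i)
    simpa only [add_mul, Finset.sum_mul, mul_assoc, hx', hy', zero_mul] using this
  have hw0 : ∀ i, w i = 0 := by
    have hsζ : ∀ ξ i, (s : H →L[ℂ] H) ((w i : H →L[ℂ] H) ξ) = 0 := by
      intro ξ
      set ζ : ι → H := fun i => (w i : H →L[ℂ] H) ξ with hζ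
      set v : ι → H := fun k => ∑ j, (b k j : H →L[ℂ] H) (ζ j) with hv
      have h4 : ∀ i, star (s : H →L[ℂ] H) ((s : H →L[ℂ] H) (ζ i)) +
          ∑ k, star (b k i : H →L[ℂ] H) (v k) = 0 := fun i => by
        have := congrArg (fun y : 𝒜.toStarSubalgebra => (y : H →L[ℂ] H) ξ) (h3 i)
        simpa [hv, hζ] using this
      -- Pairing `s* s ζ + b* b ζ = 0` with `ζ` gives `‖s ζ‖² + ‖b ζ‖² = 0`.
      have h5 : (∑ i, ‖(s : H →L[ℂ] H) (ζ i)‖ ^ 2) + ∑ k, ‖v k‖ ^ 2 = 0 := by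
        have h6 : ∑ i, inner ℂ (ζ i) (star (s : H →L[ℂ] H) ((s : H →L[ℂ] H) (ζ i)) +
            ∑ k, star (b k i : H →L[ℂ] H) (v k)) = 0 :=
          Finset.sum_eq_zero fun i _ => by rw [h4, inner_zero_right]
        simp only [inner_add_right, inner_sum, ContinuousLinearMap.star_eq_adjoint,
          ContinuousLinearMap.adjoint_inner_right] at h6
        rw [Finset.sum_add_distrib, Finset.sum_comm] at h6
        simp only [← sum_inner] at h6
        change ∑ i, inner ℂ ((s : H →L[ℂ] H) (ζ i)) ((s : H →L[ℂ] H) (ζ i)) +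
          ∑ k, inner ℂ (v k) (v k) = 0 at h6
        simp only [inner_self_eq_norm_sq_to_K] at h6
        refine (RCLike.ofReal_eq_zero (K := ℂ)).1 ?_
        push_cast
        exact h6
      have h8 := (add_eq_zero_iff_of_nonneg (Finset.sum_nonneg fun i _ => by positivity)
        (Finset.sum_nonneg fun i _ => by positivity)).1 h5
      intro i
      have := (Finset.sum_eq_zero_iff_of_nonneg fun i _ => by positivity).1 h8.1 i
        (Finset.mem_univ i)
      simpa using this
    intro i
    apply Subtype.ext
    ext ξ
    exact mem_injectiveElements.1 hs _ (hsζ ξ i)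
  refine ⟨funext fun i => F.eq_zero_of_mul_eq_zero ht ?_,
    funext fun i => F.eq_zero_of_mul_eq_zero ht ?_⟩
  · rw [hx', hw0, mul_zero]
  · simp [hy', hw0]

end FractionModel

end Core

/-! ### Closures of graphs -/

section Closure

variable {H : Type*} [NormedAddCommGroup H] [InnerProductSpace ℂ H] [CompleteSpace H]
variable {𝒜 : VonNeumannAlgebra H}

namespace FractionModel

variable {Q E : Type*} [Ring Q] [Algebra ℂ Q] [AddCommGroup E] [Module Q E]
variable (F : FractionModel 𝒜 Q E) {ι : Type*} [Fintype ι]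

/-- The graph map `ω ↦ (s ω, b ω)`. -/
def graphMap (s : 𝒜.toStarSubalgebra) (b : Matrix ι ι 𝒜.toStarSubalgebra) :
    (ι → H) →L[ℂ] PiLp 2 (fun _ : ι ⊕ ι => H) :=
  (PiLp.continuousLinearEquiv 2 ℂ (fun _ : ι ⊕ ι => H)).symm.toContinuousLinearMap ∘L
    ContinuousLinearMap.pi (Sum.elim
      (fun i => (s : H →L[ℂ] H) ∘L ContinuousLinearMap.proj i)
      (fun i => ∑ j, (b i j : H →L[ℂ] H) ∘L ContinuousLinearMap.proj j))

theorem graphMap_inl (s : 𝒜.toStarSubalgebra) (b : Matrix ι ι 𝒜.toStarSubalgebra) (ω : ι → H)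
    (i : ι) : graphMap s b ω (Sum.inl i) = (s : H →L[ℂ] H) (ω i) := by
  simp [graphMap]

theorem graphMap_inr (s : 𝒜.toStarSubalgebra) (b : Matrix ι ι 𝒜.toStarSubalgebra) (ω : ι → H)
    (i : ι) : graphMap s b ω (Sum.inr i) = ∑ j, (b i j : H →L[ℂ] H) (ω j) := by
  simp [graphMap]

-- The part of the closed graph `{N x = d y}` orthogonal to the range of `graphMap` is closed and
-- invariant under the commutant. By `column_eq_zero` it contains no nonzero column over `𝒜`, so
-- `eq_bot_of_columns` makes it zero.
include F in
theorem mem_closure_range_graphMap {N b : Matrix ι ι 𝒜.toStarSubalgebra}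
    {d s : 𝒜.toStarSubalgebra}
    (hd : d ∈ injectiveElements 𝒜) (hs : s ∈ injectiveElements 𝒜)
    (hN : ∀ i j, N i j * s = d * b i j) (u : PiLp 2 (fun _ : ι ⊕ ι => H))
    (hu : ∀ i, ∑ j, (N i j : H →L[ℂ] H) (u (Sum.inl j)) = (d : H →L[ℂ] H) (u (Sum.inr i))) :
    u ∈ closure (Set.range (graphMap s b)) := by
  classical
  let W : Submodule ℂ (PiLp 2 (fun _ : ι ⊕ ι => H)) := (graphMap s b).range.topologicalClosure
  have hWcl : IsClosed (W : Set (PiLp 2 (fun _ : ι ⊕ ι => H))) :=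
    Submodule.isClosed_topologicalClosure _
  have : CompleteSpace W := hWcl.completeSpace_coe
  have hWcoe : (W : Set (PiLp 2 (fun _ : ι ⊕ ι => H))) = closure (Set.range (graphMap s b)) := by
    rw [Submodule.topologicalClosure_coe]; rfl
  let Γ : Submodule ℂ (PiLp 2 (fun _ : ι ⊕ ι => H)) :=
    { carrier := {u | ∀ i, ∑ j, (N i j : H →L[ℂ] H) (u (Sum.inl j)) =
        (d : H →L[ℂ] H) (u (Sum.inr i))}
      add_mem' := fun {x y} hx hy i => by
        have h1 := hx i
        have h2 := hy i
        simp only [PiLp.add_apply, map_add, Finset.sum_add_distrib, h1, h2]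
      zero_mem' := fun i => by simp
      smul_mem' := fun c x hx i => by
        have h1 := hx i
        simp only [PiLp.smul_apply, map_smul, ← Finset.smul_sum, h1] }
  have hΓ : ∀ x, x ∈ Γ ↔ ∀ i, ∑ j, (N i j : H →L[ℂ] H) (x (Sum.inl j)) =
      (d : H →L[ℂ] H) (x (Sum.inr i)) := fun x => Iff.rfl
  have hΓcl : IsClosed (Γ : Set (PiLp 2 (fun _ : ι ⊕ ι => H))) := by
    have : (Γ : Set (PiLp 2 (fun _ : ι ⊕ ι => H))) =
        ⋂ i, {u | ∑ j, (N i j : H →L[ℂ] H) (u (Sum.inl j)) = (d : H →L[ℂ] H) (u (Sum.inr i))} := by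
      ext x; simp [hΓ]
    rw [this]
    exact isClosed_iInter fun i => isClosed_eq (by fun_prop) (by fun_prop)
  have hrange : ∀ ω, graphMap s b ω ∈ Γ := fun ω => by
    rw [hΓ]
    intro i
    simp only [graphMap_inl, graphMap_inr, map_sum]
    refine Finset.sum_congr rfl fun j _ => ?_
    exact congrArg (fun y : 𝒜.toStarSubalgebra => (y : H →L[ℂ] H) (ω j)) (hN i j)
  have hWΓ : W ≤ Γ := Submodule.topologicalClosure_minimal _
    (by rintro _ ⟨ω, rfl⟩; exact hrange ω) hΓcl
  have hperp : ∀ x, x ∈ Wᗮ ↔ ∀ i, star (s : H →L[ℂ] H) (x (Sum.inl i)) +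
      ∑ k, star (b k i : H →L[ℂ] H) (x (Sum.inr k)) = 0 := by
    intro x
    set g : ι → H := fun i => star (s : H →L[ℂ] H) (x (Sum.inl i)) +
      ∑ k, star (b k i : H →L[ℂ] H) (x (Sum.inr k)) with hg
    have key : ∀ ω, inner ℂ (graphMap s b ω) x = ∑ i, inner ℂ (ω i) (g i) := by
      intro ω
      simp only [hg, PiLp.inner_apply, Fintype.sum_sum_type, graphMap_inl, graphMap_inr,
        inner_add_right, inner_sum, sum_inner, ContinuousLinearMap.star_eq_adjoint,
        ContinuousLinearMap.adjoint_inner_right, Finset.sum_add_distrib]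
      rw [Finset.sum_comm (γ := ι)]
    change x ∈ Wᗮ ↔ ∀ i, g i = 0
    rw [Submodule.orthogonal_closure, Submodule.mem_orthogonal]
    constructor
    · intro h i
      have h1 := (key (Pi.single i (g i))).symm.trans (h _ ⟨Pi.single i (g i), rfl⟩)
      rw [Finset.sum_eq_single i (fun j _ hj => by simp [hj]) (by simp), Pi.single_eq_same] at h1
      exact inner_self_eq_zero (𝕜 := ℂ).1 h1
    · rintro h _ ⟨ω, rfl⟩
      refine (key ω).trans ?_
      simp [h]
  have hV : Γ ⊓ Wᗮ = ⊥ := by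
    refine eq_bot_of_columns (𝒜 := 𝒜) ?_ ?_ ?_
    · exact hΓcl.inter (Submodule.isClosed_orthogonal _)
    · rintro c hc x ⟨h1, h2⟩
      refine ⟨fun i => ?_, ?_⟩
      · have := congrArg c (h1 i)
        simpa [commutant_apply_comm hc] using this
      · rw [SetLike.mem_coe, hperp] at h2 ⊢
        intro i
        have := congrArg c (h2 i)
        have hst : ∀ (a : 𝒜.toStarSubalgebra) ξ, c (star (a : H →L[ℂ] H) ξ) =
          star (a : H →L[ℂ] H) (c ξ) := fun a => commutant_apply_comm hc (star a)
        simpa [hst] using this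
    · intro c hc
      have := F.column_eq_zero (x := fun i => c (Sum.inl i)) (y := fun i => c (Sum.inr i)) hd hs hN
        (fun i => by
          apply Subtype.ext
          ext ξ
          simpa using (hc ξ).1 i)
        (fun i => by
          apply Subtype.ext
          ext ξ
          simpa using (hperp _).1 (hc ξ).2 i)
      rintro (i | i)
      · exact congrFun this.1 i
      · exact congrFun this.2 i
  rw [← hWcoe, SetLike.mem_coe]
  have h0 : u - W.starProjection u ∈ Γ ⊓ Wᗮ :=
    ⟨Γ.sub_mem hu (hWΓ (Submodule.starProjection_apply_mem _ _)),
      Submodule.sub_starProjection_mem_orthogonal u⟩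
  rw [hV, Submodule.mem_bot, sub_eq_zero] at h0
  rw [h0]
  exact Submodule.starProjection_apply_mem _ _

/-- An operator which is densely defined in the sense of `𝒜` and acts through a matrix `M` over the
ring of fractions has the full graph of `M` as its closure. -/
theorem mem_graph_closure {K : Type*} [NormedAddCommGroup K] [InnerProductSpace ℂ K]
    (e : K ≃L[ℂ] (ι → H)) (M : Matrix ι ι Q) (T : K →ₗ.[ℂ] K)
    (hT : ∀ (x : T.domain) i, ∑ j, M i j • F.vec (e x j) = F.vec (e (T x) i))
    (hdom : ∃ s ∈ injectiveElements 𝒜, ∀ ω : ι → H,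
      e.symm (fun i => (s : H →L[ℂ] H) (ω i)) ∈ T.domain) (x y : K) :
    (x, y) ∈ T.closure.graph ↔ ∀ i, ∑ j, M i j • F.vec (e x j) = F.vec (e y i) := by
  obtain ⟨d, hd, hM⟩ := F.exists_common_left (fun k : ι × ι => M k.1 k.2)
  choose N' hN' using hM
  let N : Matrix ι ι 𝒜.toStarSubalgebra := Matrix.of fun i j => N' (i, j)
  have hN : ∀ i j, F.num d * M i j = F.num (N i j) := fun i j => hN' (i, j)
  obtain ⟨s, hs, hdom⟩ := hdom
  -- The vectors `s t ω` lie in the domain, and `M` maps them to `b ω` with `b` over `𝒜`. These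
  -- points of the graph of `T` will turn out to be dense in the graph of `M`.
  obtain ⟨t, ht, hb⟩ := F.exists_common_right (fun k : ι × ι => M k.1 k.2 * F.num s)
  choose b' hb' using hb
  let b : Matrix ι ι 𝒜.toStarSubalgebra := Matrix.of fun i j => b' (i, j)
  have hb : ∀ i j, M i j * F.num (s * t) = F.num (b i j) := fun i j => by
    rw [map_mul, ← mul_assoc]; exact hb' (i, j)
  have hst : s * t ∈ injectiveElements 𝒜 := mul_mem hs ht
  have hNb : ∀ i j, N i j * (s * t) = d * b i j := fun i j => F.num_injective (by
    rw [map_mul, ← hN, mul_assoc, hb, map_mul])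
  have hrel : ∀ ξ η : ι → H, (∀ i, ∑ j, M i j • F.vec (ξ j) = F.vec (η i)) ↔
      ∀ i, ∑ j, (N i j : H →L[ℂ] H) (ξ j) = (d : H →L[ℂ] H) (η i) := by
    refine fun ξ η => forall_congr' fun i => ?_
    rw [← F.smul_cancel hd, ← F.vec_injective.eq_iff, F.sum_vec_apply, F.vec_apply,
      Finset.smul_sum]
    simp only [smul_smul, hN]
  let Γ : Submodule ℂ (K × K) :=
    { carrier := {z | ∀ i, ∑ j, (N i j : H →L[ℂ] H) (e z.1 j) = (d : H →L[ℂ] H) (e z.2 i)}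
      add_mem' := fun {x y} hx hy i => by
        have h1 := hx i
        have h2 := hy i
        simp only [Prod.fst_add, Prod.snd_add, map_add, Pi.add_apply, Finset.sum_add_distrib, h1,
          h2]
      zero_mem' := fun i => by simp
      smul_mem' := fun c x hx i => by
        have h1 := hx i
        simp only [Prod.smul_fst, Prod.smul_snd, Pi.smul_apply, map_smul, ← Finset.smul_sum, h1] }
  have hΓ : ∀ z, z ∈ Γ ↔ ∀ i, ∑ j, (N i j : H →L[ℂ] H) (e z.1 j) = (d : H →L[ℂ] H) (e z.2 i) :=
    fun z => Iff.rfl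
  have hΓcl : IsClosed (Γ : Set (K × K)) := by
    have : (Γ : Set (K × K)) = ⋂ i, {z | ∑ j, (N i j : H →L[ℂ] H) (e z.1 j) =
        (d : H →L[ℂ] H) (e z.2 i)} := by
      ext x; simp [hΓ]
    rw [this]
    exact isClosed_iInter fun i => isClosed_eq (by fun_prop) (by fun_prop)
  have hΓfun : ∀ z ∈ Γ, z.1 = 0 → z.2 = 0 := by
    intro z hz h0
    rw [hΓ, h0] at hz
    apply e.injective
    ext i
    rw [map_zero]
    refine mem_injectiveElements.1 hd _ ?_
    rw [← hz i]
    simp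
  have hgraph : Γ.toLinearPMap.graph = Γ := Submodule.toLinearPMap_graph_eq Γ hΓfun
  have hTΓ : T.graph ≤ Γ := by
    rintro ⟨x, y⟩ hxy
    obtain ⟨z, rfl, rfl⟩ := (LinearPMap.mem_graph_iff T).1 hxy
    exact (hrel _ _).1 (hT z)
  -- `Γ = {N x = d y}` is closed, and it is a graph because `d` is injective; it extends the graph
  -- of `T`.
  have hclosable : T.IsClosable := by
    refine LinearPMap.IsClosable.leIsClosable (f := Γ.toLinearPMap) ?_
      (LinearPMap.le_of_le_graph (hTΓ.trans hgraph.ge))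
    refine LinearPMap.IsClosed.isClosable ?_
    rw [LinearPMap.IsClosed, hgraph]
    exact hΓcl
  rw [← hclosable.graph_closure_eq_closure_graph, hrel]
  refine ⟨fun h => Submodule.topologicalClosure_minimal _ hTΓ hΓcl h, fun h => ?_⟩
  have hmem := F.mem_closure_range_graphMap hd hst hNb (WithLp.toLp 2 (Sum.elim (e x) (e y)))
    (by simpa using h)
  let Φ : PiLp 2 (fun _ : ι ⊕ ι => H) → K × K := fun u =>
    (e.symm fun i => u (Sum.inl i), e.symm fun i => u (Sum.inr i))
  have hΦ : Continuous Φ := by fun_prop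
  have h1 := image_closure_subset_closure_image hΦ ⟨_, hmem, rfl⟩
  have h2 : Φ (WithLp.toLp 2 (Sum.elim (e x) (e y))) = (x, y) := by simp [Φ]
  rw [h2] at h1
  refine closure_mono ?_ h1
  rintro _ ⟨_, ⟨ω, rfl⟩, rfl⟩
  have h3 : e.symm (fun i => graphMap (s * t) b ω (Sum.inl i)) ∈ T.domain := by
    simp only [graphMap_inl]
    exact hdom fun i => (t : H →L[ℂ] H) (ω i)
  refine (LinearPMap.mem_graph_iff T).2 ?_
  refine ⟨⟨_, h3⟩, rfl, ?_⟩
  rw [ContinuousLinearEquiv.eq_symm_apply]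
  ext i
  apply F.vec_injective
  rw [← hT]
  simp only [ContinuousLinearEquiv.apply_symm_apply, graphMap_inl, graphMap_inr, F.sum_vec_apply,
    F.vec_apply, smul_smul, hb]

end FractionModel

end Closure

/-! ### Unbounded operators as elements of the ring of fractions -/

section Operators

variable {H : Type*} [NormedAddCommGroup H] [InnerProductSpace ℂ H] [CompleteSpace H]
variable {𝒜 : VonNeumannAlgebra H}

namespace FractionModel

variable {Q E : Type*} [Ring Q] [Algebra ℂ Q] [AddCommGroup E] [Module Q E]
variable (F : FractionModel 𝒜 Q E)

/-- `T` is the closed operator associated with `q`. -/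
def HasGraph (T : H →ₗ.[ℂ] H) (q : Q) : Prop :=
  ∀ x y, (x, y) ∈ T.graph ↔ q • F.vec x = F.vec y

/-- `T` is a restriction of the closed operator associated with `q` to a domain that contains the
range of an injective element of `𝒜`. -/
structure Represents (T : H →ₗ.[ℂ] H) (q : Q) : Prop where
  smul_vec : ∀ x : T.domain, q • F.vec x = F.vec (T x)
  domain : ∃ s ∈ injectiveElements 𝒜, ∀ ω, (s : H →L[ℂ] H) ω ∈ T.domain

variable {F}

theorem HasGraph.mem_domain {T : H →ₗ.[ℂ] H} {q : Q} (h : F.HasGraph T q) {x y : H}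
    (hxy : q • F.vec x = F.vec y) : x ∈ T.domain :=
  LinearPMap.mem_domain_of_mem_graph ((h x y).2 hxy)

theorem HasGraph.represents {T : H →ₗ.[ℂ] H} {q : Q} (h : F.HasGraph T q) : F.Represents T q where
  smul_vec x := (h _ _).1 (T.mem_graph x)
  domain := by
    obtain ⟨s, hs, a, ha⟩ := F.exists_right q
    refine ⟨s, hs, fun ω => h.mem_domain (y := (a : H →L[ℂ] H) ω) ?_⟩
    rw [F.vec_apply, F.vec_apply, smul_smul, ha]

theorem Represents.hasGraph_closure {T : H →ₗ.[ℂ] H} {q : Q} (h : F.Represents T q) :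
    F.HasGraph T.closure q := by
  intro x y
  have := F.mem_graph_closure (ContinuousLinearEquiv.funUnique Unit ℂ H).symm
    (Matrix.of fun _ _ => q) T (fun x _ => by simpa using h.smul_vec x)
    (by
      obtain ⟨s, hs, hdom⟩ := h.domain
      exact ⟨s, hs, fun ω => by simpa using hdom (ω ())⟩) x y
  simpa using this

-- A common right denominator `t` of the inverses `(s k)⁻¹` satisfies `t = s k * a k` for every `k`,
-- so its range lies in all the domains.
variable (F) in
include F in
theorem exists_common_domain {κ : Type*} [Finite κ] (D : κ → Submodule ℂ H)
    (hD : ∀ k, ∃ s ∈ injectiveElements 𝒜, ∀ ω, (s : H →L[ℂ] H) ω ∈ D k) :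
    ∃ s ∈ injectiveElements 𝒜, ∀ k ω, (s : H →L[ℂ] H) ω ∈ D k := by
  choose s hs h using hD
  have hu := fun k => F.isUnit_num (s k) (hs k)
  obtain ⟨t, ht, ha⟩ := F.exists_common_right fun k => ((hu k).unit⁻¹ : Qˣ).val
  refine ⟨t, ht, fun k ω => ?_⟩
  obtain ⟨a, ha⟩ := ha k
  have hta : t = s k * a := F.num_injective (by
    rw [map_mul, ← ha, ← mul_assoc, IsUnit.mul_val_inv, one_mul])
  rw [hta]
  exact h k ((a : H →L[ℂ] H) ω)

variable (F) in
include F in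
theorem exists_common_domain_inf {D D' : Submodule ℂ H}
    (hD : ∃ s ∈ injectiveElements 𝒜, ∀ ω, (s : H →L[ℂ] H) ω ∈ D)
    (hD' : ∃ s ∈ injectiveElements 𝒜, ∀ ω, (s : H →L[ℂ] H) ω ∈ D') :
    ∃ s ∈ injectiveElements 𝒜, ∀ ω, (s : H →L[ℂ] H) ω ∈ D ⊓ D' := by
  obtain ⟨s, hs, h⟩ := F.exists_common_domain (fun b : Bool => bif b then D else D')
    (by rintro (_ | _); exacts [hD', hD])
  exact ⟨s, hs, fun ω => ⟨h true ω, h false ω⟩⟩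

theorem Represents.zero : F.Represents 0 0 :=
  ⟨fun x => by simp, 1, one_mem _, fun _ => Submodule.mem_top⟩

theorem Represents.add {S T : H →ₗ.[ℂ] H} {q r : Q} (hS : F.Represents S q)
    (hT : F.Represents T r) : F.Represents (S + T) (q + r) where
  smul_vec x := by
    rw [LinearPMap.add_apply, map_add, ← hS.smul_vec, ← hT.smul_vec, add_smul]
  domain := F.exists_common_domain_inf hS.domain hT.domain

theorem Represents.sub {S T : H →ₗ.[ℂ] H} {q r : Q} (hS : F.Represents S q)
    (hT : F.Represents T r) : F.Represents (S - T) (q - r) where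
  smul_vec x := by
    rw [LinearPMap.sub_apply, map_sub, ← hS.smul_vec, ← hT.smul_vec, sub_smul]
  domain := F.exists_common_domain_inf hS.domain hT.domain

variable (F) in
theorem vec_smul (c : ℂ) (x : H) : F.vec (c • x) = algebraMap ℂ Q c • F.vec x := by
  rw [← F.num.commutes c, ← F.vec_apply]
  rfl

theorem Represents.smul {T : H →ₗ.[ℂ] H} {q : Q} (c : ℂ) (hT : F.Represents T q) :
    F.Represents (c • T) (c • q) where
  smul_vec x := by
    rw [LinearPMap.smul_apply, F.vec_smul, ← hT.smul_vec, smul_smul, Algebra.smul_def]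
  domain := hT.domain

theorem Represents.sum {κ : Type*} (t : Finset κ) {T : κ → H →ₗ.[ℂ] H} {q : κ → Q}
    (h : ∀ k ∈ t, F.Represents (T k) (q k)) : F.Represents (∑ k ∈ t, T k) (∑ k ∈ t, q k) := by
  classical
  induction t using Finset.induction_on with
  | empty => exact .zero
  | insert k t hk ih =>
    rw [Finset.sum_insert hk, Finset.sum_insert hk]
    exact (h k (Finset.mem_insert_self _ _)).add
      (ih fun l hl => h l (Finset.mem_insert_of_mem hl))

theorem Represents.idPMap : F.Represents idPMap 1 :=
  ⟨fun _ => one_smul _ _, 1, one_mem _, fun _ => Submodule.mem_top⟩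

omit [CompleteSpace H] in
theorem mem_naturalComp_domain {S T : H →ₗ.[ℂ] H} {x : H} :
    x ∈ (naturalComp S T).domain ↔ ∃ h : x ∈ T.domain, T ⟨x, h⟩ ∈ S.domain := by
  constructor
  · rintro ⟨y, hy, rfl⟩
    exact ⟨y.2, hy⟩
  · rintro ⟨h, hx⟩
    exact ⟨⟨x, h⟩, hx, rfl⟩

/-- The left factor needs its full graph: membership of `T x` in its domain is deduced from an
equation in `E`. -/
theorem Represents.naturalComp {S T : H →ₗ.[ℂ] H} {q r : Q} (hS : F.HasGraph S q)
    (hT : F.Represents T r) : F.Represents (naturalComp S T) (q * r) where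
  smul_vec x := by
    obtain ⟨h1, h2⟩ := mem_naturalComp_domain.1 x.2
    rw [mul_smul, hT.smul_vec ⟨x, h1⟩]
    exact hS.represents.smul_vec ⟨_, h2⟩
  domain := by
    obtain ⟨s, hs, hdom⟩ := hT.domain
    obtain ⟨t, ht, a, ha⟩ := F.exists_right (q * r * F.num s)
    refine ⟨s * t, mul_mem hs ht, fun ω => mem_naturalComp_domain.2 ⟨hdom _, ?_⟩⟩
    refine hS.mem_domain (y := (a : H →L[ℂ] H) ω) ?_
    rw [← hT.smul_vec, F.vec_apply, smul_smul, F.vec_apply, ← ha, map_mul, smul_smul]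
    simp only [mul_assoc]

/-- With the resolvent `R = (i - X)⁻¹`, the graph of `X` is `{(x, y) | R (i x - y) = x}`, whence `q
= i - R⁻¹`. -/
theorem exists_hasGraph_of_isRandomVariable (F : FractionModel 𝒜 Q E) {X : H →ₗ.[ℂ] H}
    (hX : IsRandomVariable 𝒜 X) : ∃ q, F.HasGraph X q := by
  obtain ⟨R, hR, h1, h2⟩ := hX.resolvent_mem
  let R' : 𝒜.toStarSubalgebra := ⟨R, hR⟩
  have hinj : R' ∈ injectiveElements 𝒜 := by
    rw [mem_injectiveElements]
    intro η (hη : R η = 0)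
    obtain ⟨h, h3⟩ := h2 η
    rw [← h3]
    have : (⟨R η, h⟩ : X.domain) = 0 := Subtype.ext hη
    rw [this, hη, smul_zero, LinearPMap.map_zero, sub_zero]
  have hu := F.isUnit_num R' hinj
  refine ⟨algebraMap ℂ Q Complex.I - (hu.unit⁻¹ : Qˣ).val, fun x y => ?_⟩
  have h3 : (x, y) ∈ X.graph ↔ R (Complex.I • x - y) = x := by
    rw [LinearPMap.mem_graph_iff]
    constructor
    · rintro ⟨z, rfl, rfl⟩
      exact h1 z
    · intro h
      obtain ⟨h4, h5⟩ := h2 (Complex.I • x - y)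
      refine ⟨⟨_, h4⟩, h, ?_⟩
      rw [show Complex.I • R (Complex.I • x - y) = Complex.I • x by rw [h]] at h5
      exact sub_right_injective h5
  rw [h3, ← F.vec_injective.eq_iff, show F.vec (R (Complex.I • x - y)) =
    F.num R' • F.vec (Complex.I • x - y) from F.vec_apply R' _]
  have h4 : F.num R' • F.vec (Complex.I • x - y) = F.vec x ↔
      F.vec (Complex.I • x - y) = (hu.unit⁻¹ : Qˣ).val • F.vec x := by
    rw [← F.smul_cancel hinj (v := (hu.unit⁻¹ : Qˣ).val • F.vec x), smul_smul,
      IsUnit.mul_val_inv, one_smul]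
  rw [h4, map_sub, F.vec_smul, sub_smul, sub_eq_iff_eq_add, sub_eq_iff_eq_add, add_comm]

variable {ι : Type*} {X : ι → H →ₗ.[ℂ] H} {x : ι → Q}

theorem represents_wordPMap (hX : ∀ i, F.HasGraph (X i) (x i)) (w : List ι) :
    F.Represents (wordPMap X w) (w.map x).prod := by
  induction w with
  | nil => exact .idPMap
  | cons i w ih =>
    rw [List.map_cons, List.prod_cons]
    exact ih.naturalComp (hX i)

theorem lift_eq_sum (x : ι → Q) (p : FreeAlgebra ℂ ι) : FreeAlgebra.lift ℂ x p =
    ∑ w ∈ (FreeAlgebra.equivMonoidAlgebraFreeMonoid p).coeff.support,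
      (FreeAlgebra.equivMonoidAlgebraFreeMonoid p).coeff w • ((FreeMonoid.toList w).map x).prod := by
  have h : FreeAlgebra.lift ℂ x = (MonoidAlgebra.lift ℂ Q (FreeMonoid ι) (FreeMonoid.lift x)).comp
      (FreeAlgebra.equivMonoidAlgebraFreeMonoid (R := ℂ) (X := ι)).toAlgHom := by
    ext i
    simp [FreeAlgebra.equivMonoidAlgebraFreeMonoid]
  rw [h]
  refine (MonoidAlgebra.lift_apply (FreeMonoid.lift x)
    (FreeAlgebra.equivMonoidAlgebraFreeMonoid p)).trans ?_
  simp only [FreeMonoid.lift_apply, Finsupp.sum]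

theorem represents_naturalEval (hX : ∀ i, F.HasGraph (X i) (x i)) (p : FreeAlgebra ℂ ι) :
    F.Represents (naturalEval X p) (FreeAlgebra.lift ℂ x p) := by
  rw [lift_eq_sum]
  exact .sum _ fun w _ => (represents_wordPMap hX _).smul _

/-- Through this, polynomial identities such as `D D' = 1` pass to the evaluated operators, although
these are closures from smaller natural domains. -/
theorem hasGraph_polyEval (hX : ∀ i, F.HasGraph (X i) (x i)) (p : FreeAlgebra ℂ ι) :
    F.HasGraph (polyEval X p) (FreeAlgebra.lift ℂ x p) :=
  (represents_naturalEval hX p).hasGraph_closure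

theorem HasGraph.closedSub {S T : H →ₗ.[ℂ] H} {q r : Q} (hS : F.HasGraph S q)
    (hT : F.HasGraph T r) : F.HasGraph (closedSub S T) (q - r) :=
  (hS.represents.sub hT.represents).hasGraph_closure

theorem mem_nullSpace {K : Type*} [NormedAddCommGroup K] [InnerProductSpace ℂ K]
    {T : K →ₗ.[ℂ] K} {x : K} : x ∈ nullSpace T ↔ (x, 0) ∈ T.graph := by
  rw [LinearPMap.mem_graph_iff]
  constructor
  · rintro ⟨y, hy, rfl⟩
    exact ⟨y, rfl, hy⟩
  · rintro ⟨y, rfl, hy⟩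
    exact ⟨y, hy, rfl⟩

theorem HasGraph.mem_nullSpace_iff {T : H →ₗ.[ℂ] H} {q : Q} (h : F.HasGraph T q) {x : H} :
    x ∈ nullSpace T ↔ q • F.vec x = 0 := by
  rw [mem_nullSpace, h, map_zero]

theorem mem_graph_matrixPMap {n : Type*} [Fintype n] {M : Matrix n n (H →ₗ.[ℂ] H)}
    {q : Matrix n n Q} (h : ∀ i j, F.Represents (M i j) (q i j))
    (x y : PiLp 2 (fun _ : n => H)) :
    (x, y) ∈ (matrixPMap M).graph ↔ ∀ i, ∑ j, q i j • F.vec (x j) = F.vec (y i) := by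
  refine F.mem_graph_closure (PiLp.continuousLinearEquiv 2 ℂ (fun _ : n => H)) q
    (naturalMatrixPMap M) (fun x i => ?_) ?_ x y
  · change _ = F.vec (∑ j, M i j ⟨x.1 j, x.2 i j⟩)
    rw [map_sum]
    exact Finset.sum_congr rfl fun j _ => (h i j).smul_vec ⟨x.1 j, x.2 i j⟩
  · obtain ⟨s, hs, hdom⟩ := F.exists_common_domain (fun k : n × n => (M k.1 k.2).domain)
      fun k => (h k.1 k.2).domain
    exact ⟨s, hs, fun ω i j => hdom (i, j) (ω j)⟩

end FractionModel

end Operators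

/-! ### The Schur complement and null spaces -/

section Linearization

/-- Solving a linear system by the Schur complement of an invertible block. -/
theorem schur_system_iff {Q E : Type*} [Ring Q] [AddCommGroup E] [Module Q E] {m : ℕ}
    {b c : Fin m → Q} {d d' : Matrix (Fin m) (Fin m) Q} (h : d * d' = 1) (h' : d' * d = 1) (a : Q)
    (u : E) (v : Fin m → E) :
    (a • u + ∑ j, b j • v j = 0 ∧ ∀ k, c k • u + ∑ j, d k j • v j = 0) ↔
      (a - ∑ j, b j * ∑ l, d' j l * c l) • u = 0 ∧ ∀ k, v k = -((∑ l, d' k l * c l) • u) := by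
  have hmul : ∀ (x y : Matrix (Fin m) (Fin m) Q) (z : Fin m → E) k,
      ∑ l, x k l • ∑ j, y l j • z j = ∑ j, (x * y) k j • z j := by
    intro x y z k
    simp only [Matrix.mul_apply, Finset.smul_sum, Finset.sum_smul, smul_smul]
    exact Finset.sum_comm
  have hone : ∀ (z : Fin m → E) k, ∑ j, (1 : Matrix (Fin m) (Fin m) Q) k j • z j = z k := by
    intro z k
    simp [Matrix.one_apply, ite_smul]
  have hv : (∀ k, c k • u + ∑ j, d k j • v j = 0) ↔ ∀ k, v k = -((∑ l, d' k l * c l) • u) := by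
    constructor
    · intro h1 k
      have h2 : ∀ l, c l • u = -∑ j, d l j • v j := fun l => eq_neg_of_add_eq_zero_left (h1 l)
      rw [Finset.sum_smul]
      simp only [mul_smul, h2, smul_neg, Finset.sum_neg_distrib, neg_neg]
      rw [hmul, h', hone]
    · intro h1 k
      have h2 : ∀ j, v j = -∑ l, d' j l • c l • u := fun j => by
        rw [h1, Finset.sum_smul]; simp only [mul_smul]
      simp only [h2, smul_neg, Finset.sum_neg_distrib]
      rw [hmul d d' (fun l => c l • u), h, hone, add_neg_cancel]
  rw [hv]
  refine and_congr_left fun h1 => ?_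
  simp only [h1, smul_neg, Finset.sum_neg_distrib, smul_smul, ← Finset.sum_smul, sub_smul,
    ← sub_eq_add_neg]

variable {H : Type*} [NormedAddCommGroup H] [InnerProductSpace ℂ H] [CompleteSpace H]
variable {𝒜 : VonNeumannAlgebra H}

namespace FractionModel

variable {Q E : Type*} [Ring Q] [Algebra ℂ Q] [AddCommGroup E] [Module Q E]
variable {F : FractionModel 𝒜 Q E}

/-- Clearing a left denominator, `s q = c`, does not change the kernel. So the null space is closed
and its projection belongs to `𝒜`. -/
theorem HasGraph.exists_nullSpace_eq_ker {T : H →ₗ.[ℂ] H} {q : Q} (h : F.HasGraph T q) :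
    ∃ c : 𝒜.toStarSubalgebra, nullSpace T = (c : H →L[ℂ] H).ker := by
  obtain ⟨s, hs, c, hc⟩ := F.exists_left q
  refine ⟨c, ?_⟩
  ext ξ
  rw [h.mem_nullSpace_iff, LinearMap.mem_ker]
  change _ ↔ (c : H →L[ℂ] H) ξ = 0
  rw [← F.smul_cancel hs, ← F.vec_injective.eq_iff, F.vec_apply, ← hc, map_zero, smul_zero,
    smul_smul]

theorem mem_nullSpace_matrixPMap {n : Type*} [Fintype n] {M : Matrix n n (H →ₗ.[ℂ] H)}
    {q : Matrix n n Q} (h : ∀ i j, F.Represents (M i j) (q i j)) (ξ : PiLp 2 (fun _ : n => H)) :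
    ξ ∈ nullSpace (matrixPMap M) ↔ ∀ i, ∑ j, q i j • F.vec (ξ j) = 0 := by
  rw [mem_nullSpace, mem_graph_matrixPMap h]
  simp

theorem exists_nullSpace_matrixPMap_eq_ker {n : Type*} [Fintype n] {M : Matrix n n (H →ₗ.[ℂ] H)}
    {q : Matrix n n Q} (h : ∀ i j, F.Represents (M i j) (q i j)) :
    ∃ N : Matrix n n 𝒜.toStarSubalgebra, nullSpace (matrixPMap M) = (matrixToCLM N).ker := by
  obtain ⟨d, hd, hN⟩ := F.exists_common_left (fun k : n × n => q k.1 k.2)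
  choose N hN using hN
  refine ⟨Matrix.of fun i j => N (i, j), ?_⟩
  ext ξ
  rw [mem_nullSpace_matrixPMap h, LinearMap.mem_ker]
  change _ ↔ matrixToCLM (Matrix.of fun i j => N (i, j)) ξ = 0
  rw [PiLp.ext_iff]
  refine forall_congr' fun i => ?_
  rw [← F.smul_cancel hd, matrixToCLM_apply, ← F.vec_injective.eq_iff, F.sum_vec_apply,
    PiLp.zero_apply, map_zero, smul_zero, Finset.smul_sum]
  simp only [smul_smul, Matrix.of_apply, ← hN]

theorem mem_nullSpace_shiftedLinearization {ι : Type*} {m : ℕ} {A : H →ₗ.[ℂ] H}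
    {X : ι → H →ₗ.[ℂ] H} {a : Q} {x : ι → Q} (hA : F.HasGraph A a)
    (hX : ∀ i, F.HasGraph (X i) (x i)) (B : Matrix (Fin 1) (Fin m) (FreeAlgebra ℂ ι))
    (C : Matrix (Fin m) (Fin 1) (FreeAlgebra ℂ ι)) (D : Matrix (Fin m) (Fin m) (FreeAlgebra ℂ ι)) :
    (∃ N : Matrix (Fin 1 ⊕ Fin m) (Fin 1 ⊕ Fin m) 𝒜.toStarSubalgebra,
      nullSpace (shiftedLinearization A X (linearizationMatrix B C D)) = (matrixToCLM N).ker) ∧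
    ∀ ξ, ξ ∈ nullSpace (shiftedLinearization A X (linearizationMatrix B C D)) ↔
      (a • F.vec (ξ (Sum.inl 0)) +
        ∑ j, FreeAlgebra.lift ℂ x (B 0 j) • F.vec (ξ (Sum.inr j)) = 0 ∧
      ∀ k, FreeAlgebra.lift ℂ x (C k 0) • F.vec (ξ (Sum.inl 0)) +
        ∑ j, FreeAlgebra.lift ℂ x (D k j) • F.vec (ξ (Sum.inr j)) = 0) := by
  have hrep : ∀ i j, F.Represents
      ((Matrix.single (Sum.inl 0) (Sum.inl 0) A + (linearizationMatrix B C D).map (polyEval X) :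
        Matrix (Fin 1 ⊕ Fin m) (Fin 1 ⊕ Fin m) (H →ₗ.[ℂ] H)) i j)
      ((Matrix.single (Sum.inl 0) (Sum.inl 0) a +
        (linearizationMatrix B C D).map (FreeAlgebra.lift ℂ x) :
        Matrix (Fin 1 ⊕ Fin m) (Fin 1 ⊕ Fin m) Q) i j) := by
    intro i j
    rw [Matrix.add_apply, Matrix.add_apply, Matrix.map_apply, Matrix.map_apply]
    refine Represents.add ?_ (hasGraph_polyEval hX _).represents
    rw [Matrix.single_apply, Matrix.single_apply]
    split_ifs
    · exact hA.represents
    · exact .zero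
  refine ⟨exists_nullSpace_matrixPMap_eq_ker hrep, fun ξ => ?_⟩
  refine (mem_nullSpace_matrixPMap hrep ξ).trans ?_
  simp [linearizationMatrix, Matrix.single_apply]

end FractionModel

end Linearization

end

/-! ### Equivalence of the two kernel projections -/

theorem mainTheorem6 {H : Type*} [NormedAddCommGroup H] [InnerProductSpace ℂ H] [CompleteSpace H]
    (𝒜 : VonNeumannAlgebra H) (τ : 𝒜.toStarSubalgebra →ₗ[ℂ] ℂ)
    (hτ : IsFaithfulNormalTraceState 𝒜 τ)
    (A : H →ₗ.[ℂ] H) (hA : IsRandomVariable 𝒜 A)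
    (X : Fin 2 → H →ₗ.[ℂ] H) (hX : ∀ i, IsRandomVariable 𝒜 (X i))
    (m : ℕ) (P : FreeAlgebra ℂ (Fin 2))
    (B : Matrix (Fin 1) (Fin m) (FreeAlgebra ℂ (Fin 2)))
    (C : Matrix (Fin m) (Fin 1) (FreeAlgebra ℂ (Fin 2)))
    (D D' : Matrix (Fin m) (Fin m) (FreeAlgebra ℂ (Fin 2)))
    (hB : ∀ i j, IsLinearPolynomial (B i j))
    (hC : ∀ i j, IsLinearPolynomial (C i j))
    (hD : ∀ i j, IsLinearPolynomial (D i j))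
    (hDD' : D * D' = 1) (hD'D : D' * D = 1)
    (hP : (B * D' * C) 0 0 = P) :
    ∃ (p : Matrix (Fin 1 ⊕ Fin m) (Fin 1 ⊕ Fin m) 𝒜.toStarSubalgebra) (q : 𝒜.toStarSubalgebra),
      IsKernelProjection (shiftedLinearization A X (linearizationMatrix B C D)) (matrixToCLM p) ∧
      IsKernelProjection (closedSub A (polyEval X P)) (q : H →L[ℂ] H) ∧
      MurrayVonNeumannEquiv p (Matrix.fromBlocks (Matrix.of fun _ _ => q) 0 0 0) ∧
      ((1 + m : ℕ) : ℂ) * matrixTrace τ p = τ q := by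
  obtain ⟨Q, E, _, _, _, _, ⟨F⟩⟩ := exists_fractionModel hτ
  obtain ⟨a, ha⟩ := F.exists_hasGraph_of_isRandomVariable hA
  choose x hx using fun i => F.exists_hasGraph_of_isRandomVariable (hX i)
  set φ := FreeAlgebra.lift ℂ x
  -- `g` is the column `D' C` evaluated in `Q`; on the kernel the lower coordinates are `-g` times
  -- the first one.
  let g : Fin m → Q := fun k => ∑ l, φ (D' k l) * φ (C l 0)
  have hsub : F.HasGraph (closedSub A (polyEval X P)) (a - ∑ j, φ (B 0 j) * g j) := by
    have : φ P = ∑ j, φ (B 0 j) * g j := by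
      rw [← hP, Matrix.mul_assoc]
      simp [Matrix.mul_apply, g]
    rw [← this]
    exact ha.closedSub (FractionModel.hasGraph_polyEval hx P)
  obtain ⟨c, hc⟩ := hsub.exists_nullSpace_eq_ker
  obtain ⟨⟨N, hN⟩, hnull⟩ := FractionModel.mem_nullSpace_shiftedLinearization ha hx B C D
  replace hnull : ∀ ξ, ξ ∈ (matrixToCLM N).ker ↔
      ξ (Sum.inl 0) ∈ (c : H →L[ℂ] H).ker ∧
        ∀ k, F.vec (ξ (Sum.inr k)) = -(g k • F.vec (ξ (Sum.inl 0))) := fun ξ => by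
    rw [← hN, hnull, ← hc, hsub.mem_nullSpace_iff]
    refine schur_system_iff (d := D.map φ) (d' := D'.map φ) ?_ ?_ a _ _
    · rw [← Matrix.map_mul, hDD', Matrix.map_one _ (map_zero φ) (map_one φ)]
    · rw [← Matrix.map_mul, hD'D, Matrix.map_one _ (map_zero φ) (map_one φ)]
  obtain ⟨p, hp⟩ := exists_matrixToCLM_eq_starProjection_ker N
  let q : 𝒜.toStarSubalgebra := ⟨_, starProjection_ker_mem c⟩
  have hmvn : MurrayVonNeumannEquiv p
      (Matrix.fromBlocks (Matrix.of fun _ _ => q) 0 0 0 : Matrix (Fin 1 ⊕ Fin m) _ _) := by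
    let e : Matrix (Fin 1 ⊕ Fin m) (Fin 1 ⊕ Fin m) 𝒜.toStarSubalgebra :=
      Matrix.single (Sum.inl 0) (Sum.inl 0) 1
    have hes : star e = e := by
      rw [Matrix.star_eq_conjTranspose, Matrix.conjTranspose_single, star_one]
    have hps : star p = p := matrixToCLM_injective (by
      rw [matrixToCLM_star, hp]; exact isStarProjection_starProjection.isSelfAdjoint)
    have he0 : ∀ ξ, matrixToCLM e ξ (Sum.inl 0) = ξ (Sum.inl 0) := fun ξ => by
      simp [e, Matrix.single_apply]
    have hek : ∀ ξ k, matrixToCLM e ξ (Sum.inr k) = 0 := fun ξ k => by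
      simp [e]
    -- `e p` reads off the first coordinate of a kernel vector. That coordinate determines the
    -- vector, so the initial projection is `p`; the final one is the projection onto the closure of
    -- the first coordinates.
    obtain ⟨v, hv1, hv2⟩ := exists_matrix_polar (e * p)
    refine ⟨v, matrixToCLM_injective ?_, matrixToCLM_injective ?_⟩
    · rw [hv1]
      ext1 u
      rw [sub_apply, one_apply_eq_self, sub_eq_iff_eq_add', ← sub_eq_iff_eq_add]
      symm
      refine Submodule.eq_starProjection_of_mem_orthogonal ?_ ?_
      · change matrixToCLM (e * p) _ = 0
        rw [matrixToCLM_mul, mul_apply_eq_comp, map_sub, hp, ← mul_apply_eq_comp,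
          isStarProjection_starProjection.isIdempotentElem.eq, sub_self, map_zero]
      · rw [sub_sub_cancel, Submodule.mem_orthogonal]
        intro w (hw : matrixToCLM (e * p) w = 0)
        have hpw : matrixToCLM p w ∈ (matrixToCLM N).ker := by
          rw [hp]; exact Submodule.starProjection_apply_mem _ _
        rw [hnull] at hpw
        have h0 : matrixToCLM p w (Sum.inl 0) = 0 := by
          rw [← he0, ← mul_apply_eq_comp, ← matrixToCLM_mul, hw, PiLp.zero_apply]
        have hpw0 : matrixToCLM p w = 0 := by
          ext i
          rcases i with i | k
          · rw [Subsingleton.elim i 0]; exact h0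
          · apply F.vec_injective
            rw [hpw.2, h0]
            simp
        rw [← ContinuousLinearMap.adjoint_inner_left, ← ContinuousLinearMap.star_eq_adjoint,
          ← matrixToCLM_star, hps, hpw0, inner_zero_left]
    · rw [hv2]
      set q' : Matrix (Fin 1 ⊕ Fin m) (Fin 1 ⊕ Fin m) 𝒜.toStarSubalgebra :=
        Matrix.fromBlocks (Matrix.of fun _ _ => q) 0 0 0
      have hq0 : ∀ ξ, matrixToCLM q' ξ (Sum.inl 0) = (q : H →L[ℂ] H) (ξ (Sum.inl 0)) := fun ξ => by
        simp [q']
      have hqk : ∀ ξ k, matrixToCLM q' ξ (Sum.inr k) = 0 := fun ξ k => by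
        simp [q']
      have hyker : ∀ w, w ∈ (matrixToCLM (star (e * p))).ker ↔
          ∀ z ∈ (matrixToCLM N).ker, inner ℂ (z (Sum.inl 0)) (w (Sum.inl 0)) = 0 := by
        intro w
        have h1 : w ∈ (matrixToCLM (star (e * p))).ker ↔
            matrixToCLM e w ∈ (matrixToCLM N).kerᗮ := by
          rw [← Submodule.starProjection_apply_eq_zero_iff, ← hp, star_mul, hes, hps,
            matrixToCLM_mul]
          exact Iff.rfl
        rw [h1, Submodule.mem_orthogonal]
        refine forall₂_congr fun z _ => ?_
        rw [PiLp.inner_apply, Fintype.sum_sum_type]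
        simp only [he0, hek, inner_zero_right, Finset.sum_const_zero, add_zero, Fin.sum_univ_one,
          Fin.isValue]
      ext1 u
      rw [sub_apply, one_apply_eq_self, sub_eq_iff_eq_add', ← sub_eq_iff_eq_add]
      symm
      refine Submodule.eq_starProjection_of_mem_orthogonal ?_ ?_
      · rw [hyker]
        intro z hz
        rw [PiLp.sub_apply, hq0]
        exact (Submodule.mem_orthogonal _ _).1
          (Submodule.sub_starProjection_mem_orthogonal (u (Sum.inl 0))) _ ((hnull z).1 hz).1
      · rw [sub_sub_cancel, Submodule.mem_orthogonal]
        intro w hw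
        rw [hyker] at hw
        -- Clearing denominators in `-g q` makes the lower coordinates attached to `q s ω` genuine
        -- vectors of `H`. As `s` has dense range, such first coordinates are dense in the range of
        -- `q`.
        obtain ⟨s, hs, hr⟩ := F.exists_common_right fun k => -(g k * F.num q)
        choose r hr using hr
        have hz : ∀ ω : H, inner ℂ ((q : H →L[ℂ] H) ((s : H →L[ℂ] H) ω)) (w (Sum.inl 0)) = 0 := by
          intro ω
          refine hw (WithLp.toLp 2 (Sum.elim
            (fun _ => (q : H →L[ℂ] H) ((s : H →L[ℂ] H) ω)) fun k => (r k : H →L[ℂ] H) ω)) ?_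
          rw [hnull]
          refine ⟨Submodule.starProjection_apply_mem _ _, fun k => ?_⟩
          change F.vec ((r k : H →L[ℂ] H) ω) =
            -(g k • F.vec ((q : H →L[ℂ] H) ((s : H →L[ℂ] H) ω)))
          rw [F.vec_apply, F.vec_apply, F.vec_apply, ← hr, smul_smul, smul_smul, ← neg_smul]
          simp only [neg_mul, mul_assoc]
        have hz' : ∀ η : H, inner ℂ ((q : H →L[ℂ] H) η) (w (Sum.inl 0)) = 0 := fun η =>
          (F.denseRange s hs).induction_on
            (p := fun η => inner ℂ ((q : H →L[ℂ] H) η) (w (Sum.inl 0)) = 0) η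
            (isClosed_eq (by fun_prop) continuous_const) hz
        rw [PiLp.inner_apply, Fintype.sum_sum_type]
        simp only [hqk, inner_zero_right, Finset.sum_const_zero, add_zero, Fin.sum_univ_one,
          Fin.isValue, hq0]
        rw [← inner_conj_symm, hz', map_zero]
  refine ⟨p, q, ⟨?_, ?_⟩, ⟨?_, ?_⟩, hmvn, ?_⟩
  · rw [hp]; exact isStarProjection_starProjection
  · rw [hN, hp]; exact Submodule.range_starProjection _
  · exact isStarProjection_starProjection
  · rw [hc]; exact Submodule.range_starProjection _
  · obtain ⟨v, h1, h2⟩ := hmvn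
    have h3 := sum_trace_mul_comm hτ (star v) v
    rw [h1, h2] at h3
    have hcard : (Fintype.card (Fin 1 ⊕ Fin m) : ℂ) = ((1 + m : ℕ) : ℂ) := by simp
    have hne : ((1 + m : ℕ) : ℂ) ≠ 0 := by exact_mod_cast (by omega : 1 + m ≠ 0)
    rw [matrixTrace, hcard, mul_inv_cancel_left₀ hne, h3]
    simp
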